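/- **Conventions.** A *bi-order* on a group $G$ is a strict total order $<$ on $G$ such that $g<h$ implies $kg<kh$ and $gk<hk$ for all $g,h,k\in G$; $G$ is *bi-orderable* if it has a bi-order. Let $X$ be a totally ordered set (finite or infinite), $F(X)$ the free group on $X$, with free generators $x_i$ $(i\in X)$, and $\widehat F(X)$ the *reduced free group*, the quotient of $F(X)$ by the relations $[x_j,gx_jg^{-1}]=1$ for all $j\in X$ and $g\in F(X)$. Let $\mathbb Z[[X]]$ be the ring of formal power series with integer coefficients in non-commuting variables $X_i$ $(i\in X)$, and let $\widehat\Lambda(X)$ be its quotient in which every monomial with a repeated variable is set to zero (that is, two series are identified when they have the same coefficients at all monomials without a repeated variable). The homomorphisms $\mu\colon F(X)\to\mathbb Z[[X]]^\times$ and $\widehat\mu\colon\widehat F(X)\to\widehat\Lambda(X)^\times$ are given by $x_i\mapsto 1+X_i$. The *Magnus order* on $F(X)$ is defined as follows: $v<w$ if $\mu(v)\neq\mu(w)$ and, at the first monomial where the coefficients of $\mu(v)$ and $\mu(w)$ differ, the coefficient of $\mu(v)$ is the smaller one; here monomials are sorted by degree and, within a degree, lexicographically with respect to the order of $X$. The *reduced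 Magnus order* on $\widehat F(X)$ is defined in the same way from $\widehat\mu$ and the monomials without a repeated variable. An *almost-direct product of free groups* (respectively, *of reduced free groups*) is a group $$G=L_\ell\rtimes_{\alpha_\ell}(L_{\ell-1}\rtimes_{\alpha_{\ell-1}}(\cdots\rtimes_{\alpha_3}(L_2\rtimes_{\alpha_2}L_1)\cdots)),\qquad \ell\ge 1,$$ where every $L_i$ is the free group (respectively, every $L_i$ is the reduced free group) on a totally ordered set $X_i$, and where, for $2\le k\le\ell$, the action $\alpha_k$ of $L_{k-1}\rtimes(\cdots\rtimes L_1)$ on $L_k$ is by automorphisms that induce the identity on the abelianization of $L_k$. The *eastern lexicographic order* on a semidirect product $K\rtimes Q$ of two ordered groups is: $hq<h'q'$ if and only if $q<q'$, or $q=q'$ and $h<h'$ $(h,h'\in K,\ q,q'\in Q)$; on $G$ it is obtained by iterating this, starting from orders on $L_1,\dots,L_\ell$. **Theorem 1.1.** Let $G$ be an almost-direct product of free groups, or of reduced free groups. Then $G$ is bi-orderable. Explicitly, the eastern lexicographic order on $G$, with each factor compared by the Magnus order (respectively, by the reduced Magnus order), is a bi-order on $G$. -/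

import Mathlib

universe u

open scoped commutatorElement

/-! ### Bi-orderable groups -/

/-- `lt` is a strict total order on the group `G` that is invariant under left and under right
multiplication. -/
structure IsBiOrder {G : Type u} [Group G] (lt : G → G → Prop) : Prop where
  irrefl : ∀ a, ¬ lt a a
  trans : ∀ a b c, lt a b → lt b c → lt a c
  total : ∀ a b, lt a b ∨ a = b ∨ lt b a
  mul_left : ∀ a b c, lt a b → lt (c * a) (c * b)
  mul_right : ∀ a b c, lt a b → lt (a * c) (b * c)

/-- A group is bi-orderable if it carries a bi-invariant strict total order. -/
def BiOrderable (G : Type u) [Group G] : Prop :=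
  ∃ lt : G → G → Prop, IsBiOrder lt

/-! ### Formal power series with integer coefficients in non-commuting variables -/

/-- `ℤ[[X]]`, the formal power series in non-commuting variables indexed by `X`; a monomial is
a word, that is a list of elements of `X`, and a series is its family of coefficients. -/
def NCPowerSeries (X : Type u) : Type u := List X → ℤ

namespace NCPowerSeries

variable {X : Type u}

instance : AddCommGroup (NCPowerSeries X) := inferInstanceAs (AddCommGroup (List X → ℤ))

/-- The Cauchy product: the coefficient at `w` is the sum of `f u * g v` over all the ways to
write `w` as a concatenation `u ++ v`. -/
instance : Mul (NCPowerSeries X) :=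
  ⟨fun f g w => ∑ i ∈ Finset.range (w.length + 1), f (w.take i) * g (w.drop i)⟩

instance : One (NCPowerSeries X) := ⟨fun w => if w.length = 0 then 1 else 0⟩

@[ext] theorem ext {f g : NCPowerSeries X} (h : ∀ w, f w = g w) : f = g := funext h

theorem add_apply (f g : NCPowerSeries X) (w : List X) : (f + g) w = f w + g w := rfl

theorem zero_apply (w : List X) : (0 : NCPowerSeries X) w = 0 := rfl

theorem mul_apply (f g : NCPowerSeries X) (w : List X) :
    (f * g) w = ∑ i ∈ Finset.range (w.length + 1), f (w.take i) * g (w.drop i) := rfl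

theorem one_apply (w : List X) :
    (1 : NCPowerSeries X) w = if w.length = 0 then 1 else 0 := rfl

/-- The series of the coefficients of `f` at the words that begin with `a`. -/
def tail (a : X) (f : NCPowerSeries X) : NCPowerSeries X := fun w => f (a :: w)

theorem mul_nil (f g : NCPowerSeries X) : (f * g) [] = f [] * g [] := by
  simp [mul_apply]

theorem mul_cons (f g : NCPowerSeries X) (a : X) (w : List X) :
    (f * g) (a :: w) = f [] * g (a :: w) + (tail a f * g) w := by
  rw [mul_apply, mul_apply, List.length_cons, Finset.sum_range_succ']
  simp [tail, add_comm]

theorem mul_eq_zero_of_left {f g : NCPowerSeries X} (h : ∀ w, f w = 0) (w : List X) :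
    (f * g) w = 0 := by
  simp [mul_apply, h]

theorem mul_assoc_apply (f g h : NCPowerSeries X) (w : List X) :
    (f * g * h) w = (f * (g * h)) w := by
  induction w generalizing f g h with
  | nil => simp [mul_nil, mul_assoc]
  | cons a w ih =>
    have key : (tail a (f * g) * h) w = f [] * (tail a g * h) w + (tail a f * g * h) w := by
      simp only [mul_apply (tail a (f * g)), mul_apply (tail a g), mul_apply (tail a f * g),
        Finset.mul_sum, ← Finset.sum_add_distrib]
      refine Finset.sum_congr rfl fun i _ => ?_
      have : tail a (f * g) (w.take i) = (f * g) (a :: w.take i) := rfl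
      rw [this, mul_cons]
      simp only [tail]
      ring
    rw [mul_cons, mul_nil, key, mul_cons f, mul_cons g, ih]
    ring

instance : Ring (NCPowerSeries X) :=
  { (inferInstance : AddCommGroup (NCPowerSeries X)),
    (inferInstance : Mul (NCPowerSeries X)),
    (inferInstance : One (NCPowerSeries X)) with
    left_distrib := fun f g h => by
      ext w
      simp only [add_apply, mul_apply, mul_add, Finset.sum_add_distrib]
    right_distrib := fun f g h => by
      ext w
      simp only [add_apply, mul_apply, add_mul, Finset.sum_add_distrib]
    zero_mul := fun f => by
      ext w
      simp [mul_apply, zero_apply]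
    mul_zero := fun f => by
      ext w
      simp [mul_apply, zero_apply]
    mul_assoc := fun f g h => by
      ext w
      exact mul_assoc_apply f g h w
    one_mul := fun f => by
      ext w
      cases w with
      | nil => simp [mul_nil, one_apply]
      | cons a w =>
        rw [mul_cons, mul_eq_zero_of_left (fun w => by simp [tail, one_apply])]
        simp [one_apply]
    mul_one := fun f => by
      ext w
      induction w generalizing f with
      | nil => simp [mul_nil, one_apply]
      | cons a w ih => rw [mul_cons, ih]; simp [one_apply, tail] }

open Classical in
/-- The variable `X_i`, as a series. -/
noncomputable def var (i : X) : NCPowerSeries X := fun w => if w = [i] then 1 else 0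

open Classical in
/-- The geometric series `1 - X_i + X_i ^ 2 - X_i ^ 3 + ⋯`. -/
noncomputable def geom (i : X) : NCPowerSeries X :=
  fun w => if ∀ a ∈ w, a = i then (-1) ^ w.length else 0

theorem geom_nil (i : X) : geom i [] = 1 := by simp [geom]

open Classical in
theorem geom_cons (i a : X) (w : List X) :
    geom i (a :: w) = if a = i then -geom i w else 0 := by
  have hc : (∀ b ∈ a :: w, b = i) ↔ a = i ∧ ∀ b ∈ w, b = i := List.forall_mem_cons
  unfold geom
  by_cases h : a = i
  · rw [if_pos h]
    by_cases h' : ∀ b ∈ w, b = i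
    · rw [if_pos h', if_pos (hc.2 ⟨h, h'⟩), List.length_cons, pow_succ]
      ring
    · rw [if_neg h', if_neg fun h'' => h' (hc.1 h'').2, neg_zero]
  · rw [if_neg h, if_neg fun h'' => h (hc.1 h'').1]

theorem one_add_var_nil (i : X) : (1 + var i) [] = 1 := by
  simp [add_apply, one_apply, var]

open Classical in
theorem one_add_var_cons (i a : X) (w : List X) :
    (1 + var i) (a :: w) = if a = i ∧ w = [] then 1 else 0 := by
  simp [add_apply, one_apply, var]

theorem one_add_var_mul_geom (i : X) : (1 + var i) * geom i = 1 := by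
  ext w
  cases w with
  | nil => rw [mul_nil, one_add_var_nil, geom_nil]; rfl
  | cons a w =>
    rw [mul_cons, one_add_var_nil, geom_cons, one_mul]
    by_cases h : a = i
    · have : tail a (1 + var i) = 1 := by
        ext v
        rw [tail, one_add_var_cons, one_apply]
        simp [h]
      rw [this, one_mul]
      simp [h, one_apply]
    · rw [mul_eq_zero_of_left (fun v => by rw [tail, one_add_var_cons]; simp [h])]
      simp [h, one_apply]

theorem geom_mul_one_add_var (i : X) : geom i * (1 + var i) = 1 := by
  ext w
  induction w with
  | nil => rw [mul_nil, one_add_var_nil, geom_nil]; rfl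
  | cons a w ih =>
    rw [mul_cons, geom_nil, one_add_var_cons, one_mul]
    by_cases h : a = i
    · have h1 : tail a (geom i) = -geom i := by
        ext v
        rw [tail, geom_cons, if_pos h]
        rfl
      have h2 : (-geom i * (1 + var i)) w = -((geom i * (1 + var i)) w) := by
        rw [neg_mul]; rfl
      rw [h1, h2, ih]
      by_cases h' : w = [] <;> simp [one_apply, h, h']
    · rw [mul_eq_zero_of_left (fun v => by rw [tail, geom_cons, if_neg h])]
      simp [one_apply, h]

/-- `1 + X_i`, as a unit of the ring of series. -/
noncomputable def oneAddVar (i : X) : (NCPowerSeries X)ˣ :=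
  ⟨1 + var i, geom i, one_add_var_mul_geom i, geom_mul_one_add_var i⟩

end NCPowerSeries

/-! ### The Magnus order of a free group -/

/-- The Magnus map: `x_i ↦ 1 + X_i` and `x_i⁻¹ ↦ 1 - X_i + X_i ^ 2 - ⋯`. -/
noncomputable def magnusMap (X : Type u) : FreeGroup X →* (NCPowerSeries X)ˣ :=
  FreeGroup.lift NCPowerSeries.oneAddVar

/-- Two families `f`, `g` of coefficients, indexed by the words that satisfy `P`, are compared at
the first word where they differ; words are sorted by degree, and lexicographically within
a degree. -/
def coeffLT {X : Type u} [LinearOrder X] {P : List X → Prop} (f g : {w : List X // P w} → ℤ) :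
    Prop :=
  ∃ w, f w < g w ∧ ∀ v, List.Shortlex (· < ·) v.1 w.1 → f v = g v

/-- The Magnus order on the free group on the ordered set `X`. -/
def magnusLT (X : Type u) [LinearOrder X] (a b : FreeGroup X) : Prop :=
  coeffLT (P := fun _ => True)
    (fun w => (magnusMap X a : NCPowerSeries X) w.1) (fun w => (magnusMap X b : NCPowerSeries X) w.1)

/-! ### The reduced Magnus order of a reduced free group -/

/-- The relators `[x_j, g x_j g⁻¹]`, for all free generators `x_j` and all `g` in the free
group. -/
def reducedRelators (X : Type u) : Set (FreeGroup X) :=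
  {r | ∃ (j : X) (g : FreeGroup X), r = ⁅FreeGroup.of j, g * FreeGroup.of j * g⁻¹⁆}

/-- The reduced free group on `X`. -/
def ReducedFreeGroup (X : Type u) : Type u := PresentedGroup (reducedRelators X)

instance (X : Type u) : Group (ReducedFreeGroup X) :=
  inferInstanceAs (Group (PresentedGroup (reducedRelators X)))

/-- Two series are congruent if they agree at all the monomials without a repeated variable, that
is, if their difference is a (possibly infinite) combination of monomials with a repeated
variable. These differences form the two-sided ideal generated by the monomials with a repeated
variable if `X` is finite, and its closure in general. -/
def repeatCon (X : Type u) : RingCon (NCPowerSeries X) where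
  r f g := ∀ w : List X, w.Nodup → f w = g w
  iseqv := ⟨fun _ _ _ => rfl, fun h w hw => (h w hw).symm,
    fun h h' w hw => (h w hw).trans (h' w hw)⟩
  add' h h' w hw := by rw [NCPowerSeries.add_apply, NCPowerSeries.add_apply, h w hw, h' w hw]
  mul' h h' w hw := by
    rw [NCPowerSeries.mul_apply, NCPowerSeries.mul_apply]
    exact Finset.sum_congr rfl fun i _ => by
      rw [h _ (hw.sublist (List.take_sublist i w)), h' _ (hw.sublist (List.drop_sublist i w))]

/-- The ring of power series in non-commuting variables in which every monomial with a repeated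
variable is set to zero. -/
abbrev ReducedNCPowerSeries (X : Type u) : Type u := (repeatCon X).Quotient

/-- The coefficient of a reduced series at a monomial without a repeated variable. -/
def ReducedNCPowerSeries.coeff {X : Type u} (f : ReducedNCPowerSeries X)
    (w : {w : List X // w.Nodup}) : ℤ :=
  Quotient.liftOn f (fun f : NCPowerSeries X => f w.1) (fun _ _ h => h w.1 w.2)

/-- `1 + X_i`, as a unit of the ring of reduced series. -/
noncomputable def reducedOneAddVar {X : Type u} (i : X) : (ReducedNCPowerSeries X)ˣ :=
  Units.map ((repeatCon X).mk' : NCPowerSeries X →* ReducedNCPowerSeries X)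
    (NCPowerSeries.oneAddVar i)

theorem NCPowerSeries.mul_var_apply {X : Type u} (f : NCPowerSeries X) (i : X) (w : List X)
    (h : i ∉ w) : (f * NCPowerSeries.var i) w = 0 := by
  refine (NCPowerSeries.mul_apply _ _ _).trans (Finset.sum_eq_zero fun k _ => ?_)
  have : w.drop k ≠ [i] := fun hk => h (List.mem_of_mem_drop (i := k) (by simp [hk]))
  simp [NCPowerSeries.var, this]

theorem reduced_var_mul_var {X : Type u} (i : X) (r : ReducedNCPowerSeries X) :
    (repeatCon X).mk' (NCPowerSeries.var i) * r * (repeatCon X).mk' (NCPowerSeries.var i) = 0 := by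
  obtain ⟨f, rfl⟩ := (repeatCon X).mk'_surjective r
  rw [← map_mul, ← map_mul, ← map_zero (repeatCon X).mk', mul_assoc]
  refine (RingCon.eq _).2 fun w hw => ?_
  cases w with
  | nil => simp [NCPowerSeries.mul_nil, NCPowerSeries.var, NCPowerSeries.zero_apply]
  | cons a w =>
    have hn : ¬ (([] : List X) = [i]) := by simp
    rw [NCPowerSeries.mul_cons, NCPowerSeries.zero_apply]
    by_cases h : a = i
    · subst h
      have : NCPowerSeries.tail a (NCPowerSeries.var a) = 1 := by
        ext v
        simp [NCPowerSeries.tail, NCPowerSeries.one_apply, NCPowerSeries.var]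
      rw [this, one_mul, NCPowerSeries.mul_var_apply f a w (List.nodup_cons.1 hw).1]
      simp [NCPowerSeries.var]
    · have hz : ∀ v, NCPowerSeries.tail a (NCPowerSeries.var i) v = 0 := fun v => by
        simp [NCPowerSeries.tail, NCPowerSeries.var, h]
      rw [NCPowerSeries.mul_eq_zero_of_left hz]
      simp [NCPowerSeries.var]

theorem reducedRelators_eq_one {X : Type u} :
    ∀ r ∈ reducedRelators X, FreeGroup.lift (reducedOneAddVar (X := X)) r = 1 := by
  rintro r ⟨j, g, rfl⟩
  rw [map_commutatorElement, commutatorElement_eq_one_iff_mul_comm]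
  simp only [map_mul, map_inv, FreeGroup.lift_apply_of]
  set G : (ReducedNCPowerSeries X)ˣ := FreeGroup.lift (reducedOneAddVar (X := X)) g
  have hj : (reducedOneAddVar j : ReducedNCPowerSeries X)
      = 1 + (repeatCon X).mk' (NCPowerSeries.var j) := by
    rw [← map_one (repeatCon X).mk', ← map_add]; rfl
  ext1
  simp only [Units.val_mul, hj]
  set x := (repeatCon X).mk' (NCPowerSeries.var j)
  have h1 : x * (G : ReducedNCPowerSeries X) * x = 0 := reduced_var_mul_var j _
  have h2 : x * ((G⁻¹ : (ReducedNCPowerSeries X)ˣ) : ReducedNCPowerSeries X) * x = 0 :=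
    reduced_var_mul_var j _
  have e1 : (G : ReducedNCPowerSeries X) * (1 + x) * ((G⁻¹ : (ReducedNCPowerSeries X)ˣ) :
      ReducedNCPowerSeries X) = 1 + G * x * ((G⁻¹ : (ReducedNCPowerSeries X)ˣ) :
      ReducedNCPowerSeries X) := by
    rw [mul_add, mul_one, add_mul, Units.mul_inv]
  have e2 : x * (G * x * ((G⁻¹ : (ReducedNCPowerSeries X)ˣ) : ReducedNCPowerSeries X)) = 0 := by
    rw [← mul_assoc, ← mul_assoc, h1, zero_mul]
  have e3 : (G * x * ((G⁻¹ : (ReducedNCPowerSeries X)ˣ) : ReducedNCPowerSeries X)) * x = 0 := by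
    rw [mul_assoc, mul_assoc, ← mul_assoc x, h2, mul_zero]
  rw [e1]
  simp only [add_mul, mul_add, one_mul, mul_one, e2, e3]
  abel

/-- The reduced Magnus expansion: `x_i ↦ 1 + X_i`. -/
noncomputable def reducedMagnusMap (X : Type u) :
    ReducedFreeGroup X →* (ReducedNCPowerSeries X)ˣ :=
  PresentedGroup.toGroup reducedRelators_eq_one

/-- The reduced Magnus order on the reduced free group on the ordered set `X`. -/
def reducedMagnusLT (X : Type u) [LinearOrder X] (a b : ReducedFreeGroup X) : Prop :=
  coeffLT (reducedMagnusMap X a : ReducedNCPowerSeries X).coeff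
    (reducedMagnusMap X b : ReducedNCPowerSeries X).coeff

/-! ### Almost-direct products -/

/-- An action of `Q` on `K` by IA-automorphisms: each of them induces the identity on the
abelianization of `K`. -/
def IsIAAction {K Q : Type u} [Group K] [Group Q] (α : Q →* MulAut K) : Prop :=
  ∀ (q : Q) (k : K), Abelianization.of (α q k) = Abelianization.of k

/-- The strict eastern lexicographic order on a semidirect product `K ⋊ Q`: the right-hand
coordinates, in `Q`, are compared first. -/
def easternLex {K Q : Type u} [Group K] [Group Q] {α : Q →* MulAut K}
    (ltK : K → K → Prop) (ltQ : Q → Q → Prop) (a b : K ⋊[α] Q) : Prop :=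
  ltQ a.right b.right ∨ (a.right = b.right ∧ ltK a.left b.left)

/-- The two kinds of factors: free groups and reduced free groups. -/
inductive FactorKind where
  | free
  | reduced

/-- The factor of the given kind on the generating set `X`. -/
def Factor : FactorKind → Type u → Type u
  | .free, X => FreeGroup X
  | .reduced, X => ReducedFreeGroup X

instance : ∀ (t : FactorKind) (X : Type u), Group (Factor t X)
  | .free, X => inferInstanceAs (Group (FreeGroup X))
  | .reduced, X => inferInstanceAs (Group (ReducedFreeGroup X))

/-- The Magnus order on a free group, the reduced Magnus order on a reduced free group. -/
def factorLT : ∀ (t : FactorKind) (X : Type u) [LinearOrder X], Factor t X → Factor t X → Prop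
  | .free, X, _ => magnusLT X
  | .reduced, X, _ => reducedMagnusLT X

/-- The data of an almost-direct product
`L X_ℓ ⋊ (L X_{ℓ-1} ⋊ (⋯ ⋊ (L X_2 ⋊ L X_1)⋯))` of free groups, or of reduced free groups, on
ordered sets of generators. The group itself is the index `G`. -/
inductive AlmostDirectProduct (t : FactorKind) : (G : Type u) → Group G → Type (u + 1)
  | single (X : Type u) [LinearOrder X] : AlmostDirectProduct t (Factor t X) inferInstance
  | semidirect {Q : Type u} [iQ : Group Q] (D : AlmostDirectProduct t Q iQ)
      (X : Type u) [LinearOrder X] (α : Q →* MulAut (Factor t X)) (hα : IsIAAction α) :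
      AlmostDirectProduct t (Factor t X ⋊[α] Q) inferInstance

/-- The (eastern) lexicographic order on an almost-direct product, with the factors compared by
the Magnus order, respectively the reduced Magnus order. -/
def AlmostDirectProduct.lexLT {t : FactorKind} :
    ∀ {G : Type u} {iG : Group G}, AlmostDirectProduct t G iG → G → G → Prop
  | _, _, @single _ X _ => factorLT t X
  | _, _, @semidirect _ _ _ D X _ _ _ => easternLex (factorLT t X) D.lexLT

/-! ### Orders -/

/-! The eastern lexicographic order on `K ⋊ Q` is a bi-order as soon as `K` and `Q` carry bi-orders
and `Q` acts on `K` by order-preserving maps (`IsBiOrder.easternLex`). By induction on the number of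
factors, everything reduces to a single factor: its Magnus order must be a bi-order that
IA-automorphisms preserve.

Both claims rest on `PreservesLeadingDifference`: if two series agree below degree `n`, only their
difference in degree `n` matters for the order, and a map that keeps this difference keeps the
order. Left and right multiplication do so because all constant coefficients are 1. Totality needs
an injective Magnus map, and finitely many terms in each degree, since `X` need not be well-ordered.

For an IA-endomorphism `φ` of a free group, extend the Magnus map and its composite with `φ` to the
group ring. Writing `a = c + ∑ b_i (x_i - 1)` lowers the degree by one: the coefficients of `b_i`
are those of `a` at words ending in `i`, and `φ` moves `x_i - 1` only in degree at least 2
(`map_sub_mem_orderGE`).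

In the reduced case multiplication by `X_i` kills words containing `i`, so `b_i` cannot be recovered
in this way. Instead, the normal closure of `x_m` is abelian, generated by the repetition-free
nested commutators ending in `x_m`, and the coefficients at words ending in `m` are dual to these
generators. So an element lies in every subgroup containing the nested commutators that its
coefficients detect (`ReducedFreeGroup.mem_of_nestedCommutator_mem`). The trivial subgroup gives
injectivity. The lower central series shows that elements agreeing to high degree differ by a deep
commutator, which an IA-endomorphism changes only in higher degree. -/

theorem IsBiOrder.comap {G H : Type u} [Group G] [Group H] {lt : H → H → Prop}
    (h : IsBiOrder lt) (e : G ≃* H) : IsBiOrder fun a b => lt (e a) (e b) where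
  irrefl a := h.irrefl _
  trans a b c := h.trans _ _ _
  total a b := by simpa using h.total (e a) (e b)
  mul_left a b c hab := by simpa using h.mul_left _ _ (e c) hab
  mul_right a b c hab := by simpa using h.mul_right _ _ (e c) hab

/-- The eastern lexicographic order is a bi-order if the action preserves the order of the
kernel. -/
theorem IsBiOrder.easternLex {K Q : Type u} [Group K] [Group Q] {α : Q →* MulAut K}
    {ltK : K → K → Prop} {ltQ : Q → Q → Prop} (hK : IsBiOrder ltK) (hQ : IsBiOrder ltQ)
    (hα : ∀ q a b, ltK a b → ltK (α q a) (α q b)) :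
    IsBiOrder (easternLex (α := α) ltK ltQ) where
  irrefl a := by
    rintro (h | ⟨-, h⟩)
    · exact hQ.irrefl _ h
    · exact hK.irrefl _ h
  trans a b c := by
    rintro (h | ⟨e, h⟩) (h' | ⟨e', h'⟩)
    · exact Or.inl (hQ.trans _ _ _ h h')
    · exact Or.inl (e' ▸ h)
    · exact Or.inl (e ▸ h')
    · exact Or.inr ⟨e.trans e', hK.trans _ _ _ h h'⟩
  total a b := by
    rcases hQ.total a.right b.right with h | e | h
    · exact Or.inl (Or.inl h)
    · rcases hK.total a.left b.left with h | e' | h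
      · exact Or.inl (Or.inr ⟨e, h⟩)
      · exact Or.inr (Or.inl (SemidirectProduct.ext e' e))
      · exact Or.inr (Or.inr (Or.inr ⟨e.symm, h⟩))
    · exact Or.inr (Or.inr (Or.inl h))
  mul_left a b c := by
    rintro (h | ⟨e, h⟩)
    · exact Or.inl (hQ.mul_left _ _ _ h)
    · refine Or.inr ⟨congrArg (c.right * ·) e, ?_⟩
      -- The left coordinate of `c * a` is `c.left * α c.right a.left`: here the action must
      -- preserve the order.
      exact hK.mul_left _ _ _ (hα _ _ _ h)
  mul_right a b c := by
    rintro (h | ⟨e, h⟩)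
    · exact Or.inl (hQ.mul_right _ _ _ h)
    · refine Or.inr ⟨congrArg (· * c.right) e, ?_⟩
      -- As the right coordinates agree, both left coordinates are multiplied by the same element.
      have := hK.mul_right _ _ (α a.right c.left) h
      rw [SemidirectProduct.mul_left, SemidirectProduct.mul_left, ← e]
      exact this

/-! ### The shortlex order on words -/

namespace List.Shortlex

variable {X : Type u} [LinearOrder X]

theorem length_le {v w : List X} (h : Shortlex (· < ·) v w) : v.length ≤ w.length := by
  rcases shortlex_def.1 h with h | h
  · exact h.le
  · exact h.1.le

instance isStrictOrder : IsStrictOrder (List X) (Shortlex (· < ·)) where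
  irrefl a h := asymm_of _ h h
  trans a b c h h' := by
    rw [shortlex_def] at *
    rcases h with h | ⟨e, h⟩ <;> rcases h' with h' | ⟨e', h'⟩
    · exact Or.inl (h.trans h')
    · exact Or.inl (e' ▸ h)
    · exact Or.inl (e ▸ h')
    · exact Or.inr ⟨e.trans e', List.lex_trans (fun h h' => lt_trans h h') h h'⟩

end List.Shortlex

/-! ### Comparison at the first differing coefficient -/

section CoeffLT

variable {X : Type u} {P : List X → Prop}

/-- Only the splitting of `w` with empty prefix evaluates `f` and `g` at `w` itself; all others use
shorter suffixes, where they agree. -/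
theorem NCPowerSeries.mul_sub_mul_left_apply (hP : ∀ u v, P (u ++ v) → P u ∧ P v)
    {f g h : NCPowerSeries X} (h1 : h [] = 1) {w : List X} (hw : P w)
    (hfg : ∀ v, P v → v.length < w.length → f v = g v) :
    (h * f) w - (h * g) w = f w - g w := by
  rw [mul_apply, mul_apply, ← Finset.sum_sub_distrib, Finset.sum_eq_single 0]
  · simp [h1]
  · intro i hi hi0
    have hd : P (w.drop i) := (hP (w.take i) (w.drop i) (by rwa [List.take_append_drop])).2
    rw [hfg _ hd (by simp at hi ⊢; omega), sub_self]
  · simp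

theorem NCPowerSeries.mul_sub_mul_right_apply (hP : ∀ u v, P (u ++ v) → P u ∧ P v)
    {f g h : NCPowerSeries X} (h1 : h [] = 1) {w : List X} (hw : P w)
    (hfg : ∀ v, P v → v.length < w.length → f v = g v) :
    (f * h) w - (g * h) w = f w - g w := by
  rw [mul_apply, mul_apply, ← Finset.sum_sub_distrib, Finset.sum_eq_single w.length]
  · simp [h1]
  · intro i hi hi0
    have hd : P (w.take i) := (hP (w.take i) (w.drop i) (by rwa [List.take_append_drop])).1
    rw [hfg _ hd (by simp at hi ⊢; omega), sub_self]
  · simp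

/-- `φ` changes the coefficients of any two elements that agree below a degree by the same amount
in that degree. -/
def PreservesLeadingDifference {G : Type u} (P : List X → Prop) (L : G → NCPowerSeries X)
    (φ : G → G) : Prop :=
  ∀ a b w, P w → (∀ v, P v → v.length < w.length → L a v = L b v) →
    L (φ a) w - L (φ b) w = L a w - L b w

variable [LinearOrder X]

/-- Shortlex compares lengths first, so `a` and `b` agree below the degree of the first differing
word. The differences at that word and at all earlier ones are unchanged, so the same word is a
witness. -/
theorem PreservesLeadingDifference.coeffLT {G : Type u} {L : G → NCPowerSeries X} {φ : G → G}
    (hφ : PreservesLeadingDifference P L φ) {a b : G}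
    (h : coeffLT (P := P) (fun w => L a w.1) (fun w => L b w.1)) :
    coeffLT (P := P) (fun w => L (φ a) w.1) (fun w => L (φ b) w.1) := by
  obtain ⟨w, hw, hlt⟩ := h
  refine ⟨w, ?_, fun v hv => ?_⟩
  · have := hφ a b w.1 w.2 fun v hv hvw => hlt ⟨v, hv⟩ (List.Shortlex.of_length_lt hvw)
    linarith
  · have := hφ a b v.1 v.2 fun v' hv' hvw => hlt ⟨v', hv'⟩
      (List.Shortlex.of_length_lt (hvw.trans_le hv.length_le))
    have := hlt v hv
    linarith

theorem coeffLT.irrefl (f : {w : List X // P w} → ℤ) : ¬ coeffLT f f := by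
  rintro ⟨w, hw, -⟩
  exact lt_irrefl _ hw

theorem coeffLT.trans {f g h : {w : List X // P w} → ℤ} (hfg : coeffLT f g) (hgh : coeffLT g h) :
    coeffLT f h := by
  obtain ⟨w, hw, hlt⟩ := hfg
  obtain ⟨w', hw', hlt'⟩ := hgh
  rcases trichotomous_of (List.Shortlex (· < ·)) w.1 w'.1 with h1 | h1 | h1
  · exact ⟨w, by rwa [← hlt' w h1], fun v hv => (hlt v hv).trans (hlt' v (_root_.trans hv h1))⟩
  · obtain rfl : w = w' := Subtype.ext h1
    exact ⟨w, hw.trans hw', fun v hv => (hlt v hv).trans (hlt' v hv)⟩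
  · exact ⟨w', by rwa [hlt w' h1], fun v hv => (hlt v (_root_.trans hv h1)).trans (hlt' v hv)⟩

/-- Shortlex is not well-founded for general `X`. But in the least degree where `f` and `g` differ,
they differ at finitely many words, and these have a minimal one. -/
theorem coeffLT.total {f g : {w : List X // P w} → ℤ}
    (hf : ∀ n, {w | w.1.length = n ∧ f w ≠ 0}.Finite)
    (hg : ∀ n, {w | w.1.length = n ∧ g w ≠ 0}.Finite) :
    coeffLT f g ∨ f = g ∨ coeffLT g f := by
  classical
  by_cases hfg : f = g
  · exact Or.inr (Or.inl hfg)
  have hex : ∃ n, ∃ w : {w : List X // P w}, w.1.length = n ∧ f w ≠ g w := by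
    obtain ⟨w, hw⟩ := Function.ne_iff.1 hfg
    exact ⟨_, w, rfl, hw⟩
  set n := Nat.find hex with hn
  have hfin : {w : {w : List X // P w} | w.1.length = n ∧ f w ≠ g w}.Finite := by
    refine ((hf n).union (hg n)).subset ?_
    rintro w ⟨hw, hne⟩
    by_cases h0 : f w = 0
    · exact Or.inr ⟨hw, fun h => hne (h0.trans h.symm)⟩
    · exact Or.inl ⟨hw, h0⟩
  have hwf : (Subtype.val '' {w : {w : List X // P w} | w.1.length = n ∧ f w ≠ g w}).WellFoundedOn
      (List.Shortlex (· < ·)) := (hfin.image _).wellFoundedOn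
  obtain ⟨⟨_, w, ⟨hwn, hw⟩, rfl⟩, -, hmin⟩ := hwf.has_min Set.univ
    (by obtain ⟨w, hw⟩ := Nat.find_spec hex; exact ⟨⟨w.1, w, hw, rfl⟩, trivial⟩)
  have key : ∀ v : {w : List X // P w}, List.Shortlex (· < ·) v.1 w.1 → f v = g v := by
    intro v hv
    by_contra hne
    have hvn : v.1.length = n := le_antisymm (hwn ▸ hv.length_le) (Nat.find_min' hex ⟨v, rfl, hne⟩)
    exact hmin ⟨v.1, v, ⟨hvn, hne⟩, rfl⟩ trivial hv
  rcases lt_or_gt_of_ne hw with h | h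
  · exact Or.inl ⟨w, h, key⟩
  · exact Or.inr (Or.inr ⟨w, h, fun v hv => (key v hv).symm⟩)

/-- The order by the first differing coefficient is a bi-order, for every faithful multiplicative
family of series with constant coefficient one and with finitely many terms in each degree. -/
theorem isBiOrder_coeffLT {G : Type u} [Group G] (hP : ∀ u v, P (u ++ v) → P u ∧ P v)
    (L : G → NCPowerSeries X) (hmul : ∀ a b w, P w → L (a * b) w = (L a * L b) w)
    (hnil : ∀ a, L a [] = 1) (hinj : ∀ a b, (∀ w, P w → L a w = L b w) → a = b)
    (hfin : ∀ a n, {w : List X | w.length = n ∧ L a w ≠ 0}.Finite) :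
    IsBiOrder fun a b => coeffLT (P := P) (fun w => L a w.1) (fun w => L b w.1) where
  irrefl a := coeffLT.irrefl _
  trans a b c := coeffLT.trans
  total a b := by
    have hfin' : ∀ a n, {w : {w : List X // P w} | w.1.length = n ∧ L a w.1 ≠ 0}.Finite :=
      fun a n => (hfin a n).preimage Subtype.val_injective.injOn
    rcases coeffLT.total (hfin' a) (hfin' b) with h | h | h
    · exact Or.inl h
    · exact Or.inr (Or.inl (hinj a b fun w hw => congrFun h ⟨w, hw⟩))
    · exact Or.inr (Or.inr h)
  mul_left a b c h := PreservesLeadingDifference.coeffLT (φ := (c * ·)) (fun a b w hw hab => by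
    rw [hmul _ _ _ hw, hmul _ _ _ hw]
    exact NCPowerSeries.mul_sub_mul_left_apply hP (hnil c) hw hab) h
  mul_right a b c h := PreservesLeadingDifference.coeffLT (φ := (· * c)) (fun a b w hw hab => by
    rw [hmul _ _ _ hw, hmul _ _ _ hw]
    exact NCPowerSeries.mul_sub_mul_right_apply hP (hnil c) hw hab) h

end CoeffLT

/-! ### Filtered rings -/

/-- `V` is a decreasing multiplicative filtration of the ring `R`. -/
structure IsMulFiltration {R : Type u} [Ring R] (V : ℕ → AddSubgroup R) : Prop where
  mem_zero : ∀ r, r ∈ V 0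
  anti : Antitone V
  mul_mem : ∀ {m n r s}, r ∈ V m → s ∈ V n → r * s ∈ V (m + n)

namespace IsMulFiltration

variable {R : Type u} [Ring R] {V : ℕ → AddSubgroup R} (hV : IsMulFiltration V)

include hV

theorem mul_mem_left {n : ℕ} {r : R} (hr : r ∈ V n) (s : R) : r * s ∈ V n :=
  hV.mul_mem hr (hV.mem_zero s)

theorem mul_mem_right {n : ℕ} {r : R} (hr : r ∈ V n) (s : R) : s * r ∈ V n := by
  simpa using hV.mul_mem (hV.mem_zero s) hr

theorem mul_sub_one_mem {n : ℕ} {a b : R} (ha : a - 1 ∈ V n) (hb : b - 1 ∈ V n) :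
    a * b - 1 ∈ V n := by
  have : a * b - 1 = (a - 1) * b + (b - 1) := by noncomm_ring
  rw [this]
  exact add_mem (hV.mul_mem_left ha b) hb

theorem inv_sub_one_mem {n : ℕ} {a : Rˣ} (ha : (a : R) - 1 ∈ V n) :
    ((a⁻¹ : Rˣ) : R) - 1 ∈ V n := by
  have : ((a⁻¹ : Rˣ) : R) - 1 = -(((a : R) - 1) * ((a⁻¹ : Rˣ) : R)) := by
    rw [sub_mul, Units.mul_inv]; noncomm_ring
  rw [this]
  exact neg_mem (hV.mul_mem_left ha _)

/-- From `(⁅a, b⁆ - 1) * (b * a) = a * b - b * a = (a - 1) * (b - 1) - (b - 1) * (a - 1)`, dividing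
by the unit `b * a`. -/
theorem commutator_sub_one_mem {m n : ℕ} {a b : Rˣ} (ha : (a : R) - 1 ∈ V m)
    (hb : (b : R) - 1 ∈ V n) : ((⁅a, b⁆ : Rˣ) : R) - 1 ∈ V (m + n) := by
  have h : (((⁅a, b⁆ : Rˣ) : R) - 1) * (b * a) = (a - 1) * (b - 1) - (b - 1) * (a - 1) := by
    have h1 : ⁅a, b⁆ * (b * a) = a * b := by rw [commutatorElement_def]; group
    have h2 : ((⁅a, b⁆ : Rˣ) : R) * (b * a) = a * b := by exact_mod_cast congrArg Units.val h1
    rw [sub_mul, h2]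
    noncomm_ring
  have h' : ((⁅a, b⁆ : Rˣ) : R) - 1
      = ((a - 1) * (b - 1) - (b - 1) * (a - 1)) * (((b * a)⁻¹ : Rˣ) : R) := by
    rw [← h, mul_assoc, ← Units.val_mul, Units.mul_inv, mul_one]
  rw [h']
  refine hV.mul_mem_left (sub_mem (hV.mul_mem ha hb) ?_) _
  rw [add_comm]
  exact hV.mul_mem hb ha

/-- Modulo higher terms, the commutator of units is the commutator of the ring. -/
theorem commutator_sub_mem {m n : ℕ} (hm : 1 ≤ m) (hn : 1 ≤ n) {a b : Rˣ}
    (ha : (a : R) - 1 ∈ V m) (hb : (b : R) - 1 ∈ V n) :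
    ((⁅a, b⁆ : Rˣ) : R) - 1 - ((a - 1) * (b - 1) - (b - 1) * (a - 1)) ∈ V (m + n + 1) := by
  have h : (((⁅a, b⁆ : Rˣ) : R) - 1) * (b * a) = (a - 1) * (b - 1) - (b - 1) * (a - 1) := by
    have h1 : ⁅a, b⁆ * (b * a) = a * b := by rw [commutatorElement_def]; group
    have h2 : ((⁅a, b⁆ : Rˣ) : R) * (b * a) = a * b := by exact_mod_cast congrArg Units.val h1
    rw [sub_mul, h2]
    noncomm_ring
  rw [← h]
  have : ((⁅a, b⁆ : Rˣ) : R) - 1 - (((⁅a, b⁆ : Rˣ) : R) - 1) * (b * a)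
      = -((((⁅a, b⁆ : Rˣ) : R) - 1) * (b * a - 1)) := by noncomm_ring
  rw [this]
  exact neg_mem (hV.mul_mem (hV.commutator_sub_one_mem ha hb)
    (hV.mul_sub_one_mem (hV.anti hn hb) (hV.anti hm ha)))

/-- Both group commutators may be replaced by ring commutators up to `V (m + n + 1)`, and ring
commutators are biadditive. -/
theorem commutator_sub_commutator_mem {m n : ℕ} (hm : 1 ≤ m) (hn : 1 ≤ n) {a b a' b' : Rˣ}
    (ha : (a : R) - 1 ∈ V m) (hb : (b : R) - 1 ∈ V n)
    (ha' : (a' : R) - a ∈ V (m + 1)) (hb' : (b' : R) - b ∈ V (n + 1)) :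
    ((⁅a', b'⁆ : Rˣ) : R) - (⁅a, b⁆ : Rˣ) ∈ V (m + n + 1) := by
  have ha1 : (a' : R) - 1 ∈ V m := by
    rw [← sub_add_sub_cancel (a' : R) a 1]
    exact add_mem (hV.anti m.le_succ ha') ha
  have hb1 : (b' : R) - 1 ∈ V n := by
    rw [← sub_add_sub_cancel (b' : R) b 1]
    exact add_mem (hV.anti n.le_succ hb') hb
  have h := sub_mem (hV.commutator_sub_mem hm hn ha1 hb1) (hV.commutator_sub_mem hm hn ha hb)
  have e : ((⁅a', b'⁆ : Rˣ) : R) - (⁅a, b⁆ : Rˣ)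
      = (((⁅a', b'⁆ : Rˣ) : R) - 1 - ((a' - 1) * (b' - 1) - (b' - 1) * (a' - 1))
          - (((⁅a, b⁆ : Rˣ) : R) - 1 - ((a - 1) * (b - 1) - (b - 1) * (a - 1))))
        + (((a' : R) - a) * (b' - 1) + (a - 1) * (b' - b))
        - (((b' : R) - b) * (a' - 1) + (b - 1) * (a' - a)) := by noncomm_ring
  rw [e]
  refine sub_mem (add_mem h (add_mem ?_ ?_)) (add_mem ?_ ?_)
  · have := hV.mul_mem ha' hb1
    rwa [show m + 1 + n = m + n + 1 by ring] at this
  · exact (hV.mul_mem ha hb' : _ ∈ V (m + (n + 1)))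
  · have := hV.mul_mem hb' ha1
    rwa [show n + 1 + m = m + n + 1 by ring] at this
  · have := hV.mul_mem hb ha'
    rwa [show n + (m + 1) = m + n + 1 by ring] at this

variable {G : Type u} [Group G] {μ : G →* Rˣ}

/-- The elements sent into `1 + V n` form a subgroup, so commutators suffice. The shift by one comes
from `lowerCentralSeries 0` being the whole group. -/
theorem sub_one_mem_of_mem_lowerCentralSeries (hμ : ∀ g, (μ g : R) - 1 ∈ V 1) (n : ℕ) {g : G}
    (hg : g ∈ (⊤ : Subgroup G).lowerCentralSeries n) : (μ g : R) - 1 ∈ V (n + 1) := by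
  let S : ℕ → Subgroup G := fun n =>
    { carrier := {g | (μ g : R) - 1 ∈ V n}
      mul_mem' := fun {a b} ha hb => by
        simpa using hV.mul_sub_one_mem ha hb
      one_mem' := by simp [zero_mem]
      inv_mem' := fun {a} ha => by
        simpa using hV.inv_sub_one_mem (a := μ a) ha }
  suffices h : (⊤ : Subgroup G).lowerCentralSeries n ≤ S (n + 1) from h hg
  clear hg
  induction n with
  | zero => exact fun g _ => hμ g
  | succ n ih =>
    rw [Subgroup.lowerCentralSeries_succ, Subgroup.commutator_le]
    intro a ha b _
    change (μ ⁅a, b⁆ : R) - 1 ∈ V (n + 1 + 1)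
    rw [map_commutatorElement]
    exact hV.commutator_sub_one_mem (ih ha) (hμ b)

/-- An endomorphism that is trivial on the abelianization is trivial to first order. -/
theorem map_sub_mem_two (hμ : ∀ g, (μ g : R) - 1 ∈ V 1) {φ : G →* G}
    (hφ : ∀ g, Abelianization.of (φ g) = Abelianization.of g) (g : G) :
    (μ (φ g) : R) - μ g ∈ V 2 := by
  have h : φ g * g⁻¹ ∈ (⊤ : Subgroup G).lowerCentralSeries 1 := by
    rw [Subgroup.top_lowerCentralSeries_one, ← Abelianization.ker_of, MonoidHom.mem_ker, map_mul,
      map_inv, hφ, mul_inv_cancel]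
  have h' := hV.mul_mem_left (hV.sub_one_mem_of_mem_lowerCentralSeries hμ 1 h) (μ g)
  rwa [sub_mul, ← Units.val_mul, ← map_mul, inv_mul_cancel_right, one_mul] at h'

/-- An endomorphism that is trivial on the abelianization is trivial on the successive quotients
of the lower central series. -/
theorem map_sub_mem_of_mem_lowerCentralSeries (hμ : ∀ g, (μ g : R) - 1 ∈ V 1) {φ : G →* G}
    (hφ : ∀ g, Abelianization.of (φ g) = Abelianization.of g) (n : ℕ) {g : G}
    (hg : g ∈ (⊤ : Subgroup G).lowerCentralSeries n) : (μ (φ g) : R) - μ g ∈ V (n + 2) := by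
  -- `S n` is the equalizer of `μ ∘ φ` and `μ` modulo the two-sided ideal `V n`, hence a subgroup,
  -- and it suffices to treat commutators.
  let S : ℕ → Subgroup G := fun n =>
    { carrier := {g | (μ (φ g) : R) - μ g ∈ V n}
      mul_mem' := fun {a b} ha hb => by
        change (μ (φ (a * b)) : R) - μ (a * b) ∈ V n
        simp only [map_mul, Units.val_mul]
        have e : (μ (φ a) : R) * μ (φ b) - μ a * μ b
            = (μ (φ a) - μ a) * μ (φ b) + μ a * (μ (φ b) - μ b) := by noncomm_ring
        rw [e]
        exact add_mem (hV.mul_mem_left ha _) (hV.mul_mem_right hb _)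
      one_mem' := by simp [zero_mem]
      inv_mem' := fun {a} ha => by
        change (μ (φ a⁻¹) : R) - μ a⁻¹ ∈ V n
        simp only [map_inv]
        have e : (((μ (φ a))⁻¹ : Rˣ) : R) - ((μ a)⁻¹ : Rˣ)
            = -((((μ (φ a))⁻¹ : Rˣ) : R) * ((μ (φ a) - μ a) * ((μ a)⁻¹ : Rˣ))) := by
          rw [sub_mul, mul_sub, Units.mul_inv, ← mul_assoc, Units.inv_mul]
          noncomm_ring
        rw [e]
        exact neg_mem (hV.mul_mem_right (hV.mul_mem_left ha _) _) }
  suffices h : (⊤ : Subgroup G).lowerCentralSeries n ≤ S (n + 2) from h hg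
  clear hg
  induction n with
  | zero => exact fun g _ => hV.map_sub_mem_two hμ hφ g
  | succ n ih =>
    rw [Subgroup.lowerCentralSeries_succ, Subgroup.commutator_le]
    intro a ha b _
    change (μ (φ ⁅a, b⁆) : R) - μ ⁅a, b⁆ ∈ V (n + 1 + 1 + 1)
    rw [map_commutatorElement, map_commutatorElement, map_commutatorElement]
    exact hV.commutator_sub_commutator_mem (by omega) le_rfl
      (hV.sub_one_mem_of_mem_lowerCentralSeries hμ n ha) (hμ b) (ih ha)
      (hV.map_sub_mem_two hμ hφ b)

end IsMulFiltration

/-! ### Power series -/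

namespace NCPowerSeries

variable {X : Type u}

/-- The series without terms of degree less than `n`. -/
def orderGE (X : Type u) (n : ℕ) : AddSubgroup (NCPowerSeries X) where
  carrier := {f | ∀ w, w.length < n → f w = 0}
  add_mem' hf hg w hw := by rw [add_apply, hf w hw, hg w hw, add_zero]
  zero_mem' _ _ := rfl
  neg_mem' {f} hf w hw := by
    change -f w = 0
    rw [hf w hw, neg_zero]

theorem sub_apply (f g : NCPowerSeries X) (w : List X) : (f - g) w = f w - g w := rfl

theorem isMulFiltration_orderGE : IsMulFiltration (orderGE X) where
  mem_zero f w hw := absurd hw (Nat.not_lt_zero _)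
  anti m n hmn f hf w hw := hf w (hw.trans_le hmn)
  mul_mem {m n f g} hf hg w hw := by
    rw [mul_apply]
    refine Finset.sum_eq_zero fun i hi => ?_
    by_cases h : (w.take i).length < m
    · rw [hf _ h, zero_mul]
    · rw [hg (w.drop i) (by simp at h hi ⊢; omega), mul_zero]

theorem one_add_var_mul_apply (i : X) (f : NCPowerSeries X) {v : List X} (hv : v.head? ≠ some i) :
    ((1 + var i) * f) v = f v := by
  cases v with
  | nil => rw [mul_nil, one_add_var_nil, one_mul]
  | cons a v =>
    have h : a ≠ i := fun h => hv (by simp [h])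
    rw [mul_cons, one_add_var_nil, one_mul,
      mul_eq_zero_of_left (fun u => by rw [tail, one_add_var_cons]; simp [h]), add_zero]

theorem one_add_var_mul_cons (i : X) (f : NCPowerSeries X) (v : List X) :
    ((1 + var i) * f) (i :: v) = f (i :: v) + f v := by
  have : tail i (1 + var i) = 1 := by
    ext u
    rw [tail, one_add_var_cons, one_apply]
    simp
  rw [mul_cons, one_add_var_nil, one_mul, this, one_mul]

/-- For `v` not beginning with `i`, multiplication by `1 + X_i` acts on the pair `(f v, f (i :: v))`
by a unipotent matrix, whose `n`-th power has off-diagonal entry `n`. -/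
theorem oneAddVar_zpow_mul (i : X) (f : NCPowerSeries X) (n : ℤ) :
    ∀ v : List X, v.head? ≠ some i →
      (((oneAddVar i ^ n : (NCPowerSeries X)ˣ) : NCPowerSeries X) * f) v = f v ∧
      (((oneAddVar i ^ n : (NCPowerSeries X)ˣ) : NCPowerSeries X) * f) (i :: v)
        = f (i :: v) + n * f v := by
  have step : ∀ n : ℤ, ((oneAddVar i ^ (n + 1) : (NCPowerSeries X)ˣ) : NCPowerSeries X) * f
      = (1 + var i) * (((oneAddVar i ^ n : (NCPowerSeries X)ˣ) : NCPowerSeries X) * f) := by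
    intro n
    rw [add_comm n 1, zpow_one_add, Units.val_mul, mul_assoc]
    rfl
  induction n with
  | zero => intro v _; simp
  | succ n ih =>
    intro v hv
    obtain ⟨h1, h2⟩ := ih v hv
    rw [step, one_add_var_mul_apply i _ hv, one_add_var_mul_cons, h1, h2]
    refine ⟨rfl, ?_⟩
    ring
  | pred n ih =>
    intro v hv
    obtain ⟨h1, h2⟩ := ih v hv
    have e := step (-(n : ℤ) - 1)
    rw [sub_add_cancel] at e
    rw [e, one_add_var_mul_apply i _ hv] at h1
    rw [e, one_add_var_mul_cons, h1] at h2
    refine ⟨h1, ?_⟩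
    linarith

theorem mul_var_append (f : NCPowerSeries X) (i j : X) (v : List X) [Decidable (j = i)] :
    (f * var j) (v ++ [i]) = if j = i then f v else 0 := by
  classical
  have h : ∀ k ∈ Finset.range ((v ++ [i]).length + 1), k ≠ v.length →
      f ((v ++ [i]).take k) * var j ((v ++ [i]).drop k) = 0 := by
    intro k hk hkv
    have : (v ++ [i]).drop k ≠ [j] := fun h => hkv (by
      have := congrArg List.length h
      simp at this hk
      omega)
    simp [var, this]
  rw [mul_apply, Finset.sum_eq_single_of_mem v.length (by simp) h]
  simp [var, eq_comm]

/-- Finitely many terms in each degree. -/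
def IsLocallyFinite (f : NCPowerSeries X) : Prop :=
  ∀ n, {w : List X | w.length = n ∧ f w ≠ 0}.Finite

theorem IsLocallyFinite.mul {f g : NCPowerSeries X} (hf : IsLocallyFinite f)
    (hg : IsLocallyFinite g) : IsLocallyFinite (f * g) := by
  intro n
  refine ((Finset.range (n + 1)).finite_toSet.biUnion fun i _ =>
    Set.Finite.image2 (· ++ ·) (hf i) (hg (n - i))).subset ?_
  rintro w ⟨hw, hne⟩
  obtain ⟨i, hi, h⟩ := Finset.exists_ne_zero_of_sum_ne_zero ((mul_apply f g w).symm.trans_ne hne)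
  rw [hw] at hi
  refine Set.mem_biUnion (Finset.mem_coe.2 hi) ⟨w.take i, ⟨?_, left_ne_zero_of_mul h⟩,
    w.drop i, ⟨by simp [hw], right_ne_zero_of_mul h⟩, List.take_append_drop i w⟩
  simp at hi ⊢
  omega

theorem isLocallyFinite_of_forall_eq {f : NCPowerSeries X} (i : X)
    (h : ∀ w, f w ≠ 0 → ∀ a ∈ w, a = i) : IsLocallyFinite f := by
  refine fun n => (Set.finite_singleton (List.replicate n i)).subset ?_
  rintro w ⟨hw, hne⟩
  exact List.eq_replicate_iff.2 ⟨hw, h w hne⟩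

end NCPowerSeries

/-! ### The Magnus map -/

section MagnusMap

open NCPowerSeries

variable {X : Type u}

theorem magnusMap_of (i : X) :
    (magnusMap X (FreeGroup.of i) : NCPowerSeries X) = 1 + NCPowerSeries.var i := by
  rw [magnusMap, FreeGroup.lift_apply_of]
  rfl

theorem magnusMap_of_inv (i : X) :
    (magnusMap X (FreeGroup.of i)⁻¹ : NCPowerSeries X) = geom i := by
  rw [magnusMap, map_inv, FreeGroup.lift_apply_of]
  rfl

theorem magnusMap_nil (a : FreeGroup X) : (magnusMap X a : NCPowerSeries X) [] = 1 := by
  induction a using FreeGroup.induction_on with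
  | C1 => simp [NCPowerSeries.one_apply]
  | of i => rw [magnusMap_of, one_add_var_nil]
  | inv_of i _ => rw [magnusMap_of_inv, geom_nil]
  | mul a b ha hb => rw [map_mul, Units.val_mul, mul_nil, ha, hb, one_mul]

theorem magnusMap_sub_one_mem (a : FreeGroup X) :
    (magnusMap X a : NCPowerSeries X) - 1 ∈ orderGE X 1 := by
  intro w hw
  obtain rfl : w = [] := List.length_eq_zero_iff.1 (by omega)
  rw [sub_apply, magnusMap_nil]
  rfl

theorem isLocallyFinite_magnusMap (a : FreeGroup X) :
    IsLocallyFinite (magnusMap X a : NCPowerSeries X) := by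
  classical
  induction a using FreeGroup.induction_on with
  | C1 =>
    refine fun n => (Set.finite_singleton []).subset ?_
    rintro w ⟨-, hw⟩
    by_contra h
    simp [NCPowerSeries.one_apply] at hw
    exact h hw
  | of i =>
    refine isLocallyFinite_of_forall_eq i fun w hw => ?_
    rw [magnusMap_of] at hw
    cases w with
    | nil => simp
    | cons a w =>
      rw [one_add_var_cons] at hw
      have := of_not_not fun h => hw (if_neg h)
      simp [this]
  | inv_of i _ =>
    refine isLocallyFinite_of_forall_eq i fun w hw => ?_
    rw [magnusMap_of_inv] at hw
    exact of_not_not fun h => hw (if_neg h)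
  | mul a b ha hb => rw [map_mul, Units.val_mul]; exact ha.mul hb

/-- Among the words without equal neighbours at which `f` does not vanish, the longest ones have
the length of `w` and satisfy `S`, and `w` is one of them. -/
def IsTopWord (S : List X → Prop) (f : NCPowerSeries X) (w : List X) : Prop :=
  w.IsChain (· ≠ ·) ∧ S w ∧ f w ≠ 0 ∧
    ∀ v : List X, v.IsChain (· ≠ ·) → w.length ≤ v.length → f v ≠ 0 → v.length = w.length ∧ S v

/-- No longest word begins with `i`, so the term `n X_i` prolongs each of them by the letter `i`,
with coefficient multiplied by `n ≠ 0`, while nothing already present in `f` is that long. -/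
theorem IsTopWord.oneAddVar_zpow {i : X} {f : NCPowerSeries X} {w : List X}
    (h : IsTopWord (fun v => v.head? ≠ some i) f w) {n : ℤ} (hn : n ≠ 0) :
    IsTopWord (fun v => v.head? = some i)
      (((oneAddVar i ^ n : (NCPowerSeries X)ˣ) : NCPowerSeries X) * f) (i :: w) := by
  obtain ⟨hc, hw, hne, hmax⟩ := h
  have hc' : (i :: w).IsChain (· ≠ ·) :=
    List.isChain_cons.2 ⟨fun y hy h => hw (by rw [h]; exact hy), hc⟩
  refine ⟨hc', rfl, ?_, ?_⟩
  · rw [(oneAddVar_zpow_mul i f n w hw).2]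
    have : f (i :: w) = 0 := by
      by_contra h0
      exact (hmax _ hc' (by simp) h0).2 rfl
    rw [this, zero_add]
    exact mul_ne_zero hn hne
  · intro v hv hlen hv0
    by_cases hvi : v.head? = some i
    · obtain ⟨v, rfl⟩ : ∃ v', v = i :: v' := by
        cases v with
        | nil => simp at hvi
        | cons a v => exact ⟨v, by simp at hvi; rw [hvi]⟩
      obtain ⟨h1, h2⟩ := List.isChain_cons.1 hv
      have hv' : v.head? ≠ some i := fun h => h1 i h rfl
      rw [(oneAddVar_zpow_mul i f n v hv').2] at hv0
      have : f (i :: v) = 0 := by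
        by_contra h0
        exact (hmax _ hv (by simp at hlen ⊢; omega) h0).2 rfl
      rw [this, zero_add] at hv0
      refine ⟨?_, hvi⟩
      have := (hmax v h2 (by simpa using hlen) (right_ne_zero_of_mul hv0)).1
      simp [this]
    · rw [(oneAddVar_zpow_mul i f n v hvi).1] at hv0
      have := (hmax v hv (by simp at hlen; omega) hv0).1
      simp at hlen
      omega

/-- A free group is a free product of infinite cyclic groups; this gives access to normal forms
whose syllables are nontrivial powers of generators. -/
theorem magnusMap_eq_lift : magnusMap X =
    (Monoid.CoprodI.lift fun i => FreeGroup.lift fun _ : Unit => oneAddVar i).comp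
      (freeGroupEquivCoprodI (ι := X)).toMonoidHom := by
  ext i : 1
  simp [magnusMap]

/-- Syllables are multiplied on from the right end to the left, each prolonging the top words by one
letter. The arbitrary `f` stands for the product of the syllables already treated. -/
theorem exists_isTopWord_neWord_mul {i j : X}
    (w : Monoid.CoprodI.NeWord (fun _ : X => FreeGroup Unit) i j) :
    ∀ (f : NCPowerSeries X), (∃ v, IsTopWord (fun v => v.head? ≠ some j) f v) →
      ∃ v, IsTopWord (fun v => v.head? = some i)
        (((Monoid.CoprodI.lift (fun i => FreeGroup.lift fun _ : Unit => oneAddVar i) w.prod :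
          (NCPowerSeries X)ˣ) : NCPowerSeries X) * f) v := by
  induction w with
  | @singleton i g hg =>
    rintro f ⟨v, hv⟩
    obtain ⟨n, rfl⟩ := FreeGroup.freeGroupUnitEquivInt.symm.surjective g
    have hn : n ≠ 0 := by
      rintro rfl
      exact hg (by simp [FreeGroup.freeGroupUnitEquivInt])
    have e : FreeGroup.freeGroupUnitEquivInt.symm n = FreeGroup.of () ^ n := rfl
    refine ⟨i :: v, ?_⟩
    rw [Monoid.CoprodI.NeWord.prod_singleton, Monoid.CoprodI.lift_of, e, map_zpow,
      FreeGroup.lift_apply_of]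
    exact hv.oneAddVar_zpow hn
  | @append i j k l w₁ hne w₂ ih₁ ih₂ =>
    intro f hf
    obtain ⟨v, h1, h2, h3, h4⟩ := ih₂ f hf
    rw [Monoid.CoprodI.NeWord.append_prod, map_mul, Units.val_mul, mul_assoc]
    -- Neighbouring syllables have different letters: beginning with `k` excludes beginning with
    -- `j`.
    refine ih₁ _ ⟨v, h1, ?_, h3, fun u hu hl h0 => ⟨(h4 u hu hl h0).1, ?_⟩⟩
    · change v.head? = _ at h2
      rw [h2]
      simpa using hne.symm
    · have : u.head? = _ := (h4 u hu hl h0).2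
      change u.head? ≠ _
      rw [this]
      simpa using hne.symm

/-- Magnus: the free group embeds into the units of the ring of power series. -/
theorem magnusMap_injective (X : Type u) : Function.Injective (magnusMap X) := by
  classical
  rw [magnusMap_eq_lift, MonoidHom.coe_comp]
  refine Function.Injective.comp ?_ (freeGroupEquivCoprodI (ι := X)).injective
  rw [injective_iff_map_eq_one]
  intro a ha
  by_contra hne
  obtain ⟨w, rfl⟩ := Monoid.CoprodI.Word.equiv.symm.surjective a
  have hw : w ≠ Monoid.CoprodI.Word.empty := by
    rintro rfl
    exact hne Monoid.CoprodI.Word.prod_empty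
  obtain ⟨i, j, w, rfl⟩ := Monoid.CoprodI.NeWord.of_word w hw
  -- Start from the series `1`, with the empty word on top. The product then has a nonzero
  -- coefficient at a nonempty word, so it is not `1`.
  have htop : IsTopWord (fun v => v.head? ≠ some j) (1 : NCPowerSeries X) [] := by
    refine ⟨by simp, by simp, by simp [NCPowerSeries.one_apply], fun v _ _ hv => ?_⟩
    obtain rfl : v = [] := by
      by_contra h
      exact hv (by simp [NCPowerSeries.one_apply, h])
    simp
  obtain ⟨v, -, h2, h3, -⟩ := exists_isTopWord_neWord_mul w 1 ⟨_, htop⟩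
  have h3' : ((Monoid.CoprodI.lift (fun i => FreeGroup.lift fun _ : Unit => oneAddVar i)
      w.toWord.prod : (NCPowerSeries X)ˣ) : NCPowerSeries X) = 1 := congrArg Units.val ha
  rw [show w.prod = w.toWord.prod from rfl, h3', mul_one, NCPowerSeries.one_apply] at h3
  have hv : v = [] := List.length_eq_zero_iff.1 (of_not_not fun h => h3 (if_neg h))
  subst hv
  simp at h2

end MagnusMap

/-! ### IA-endomorphisms of a free group -/

section FreeIA

variable {X : Type u}

/-- Fox's fundamental formula: an element of the group ring of a free group is a left linear
combination of the `x_i - 1` up to an integer. -/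
theorem exists_fox_decomposition (a : MonoidAlgebra ℤ (FreeGroup X)) :
    ∃ (c : ℤ) (b : X →₀ MonoidAlgebra ℤ (FreeGroup X)),
      a = c • 1 + b.sum fun i r => r * (MonoidAlgebra.of ℤ _ (FreeGroup.of i) - 1) := by
  classical
  let Ψ : (X →₀ MonoidAlgebra ℤ (FreeGroup X)) →+ MonoidAlgebra ℤ (FreeGroup X) :=
    Finsupp.liftAddHom fun i =>
      AddMonoidHom.mulRight (MonoidAlgebra.of ℤ (FreeGroup X) (FreeGroup.of i) - 1)
  have hΨ : ∀ r i, r * (MonoidAlgebra.of ℤ (FreeGroup X) (FreeGroup.of i) - 1) ∈ Ψ.range :=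
    fun r i => ⟨Finsupp.single i r, by simp [Ψ]⟩
  -- Quantifying over `r` makes the induction work: `r g h - r = ((r g) h - r g) + (r g - r)`, and
  -- `r x⁻¹ - r = -(r x⁻¹) (x - 1)`.
  have h1 : ∀ (g : FreeGroup X) (r : MonoidAlgebra ℤ (FreeGroup X)),
      r * MonoidAlgebra.of ℤ (FreeGroup X) g - r ∈ Ψ.range := by
    intro g
    induction g using FreeGroup.induction_on with
    | C1 => intro r; rw [map_one, mul_one, sub_self]; exact zero_mem _
    | of i => intro r; simpa [mul_sub] using hΨ r i
    | inv_of i _ =>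
      intro r
      have := hΨ (r * MonoidAlgebra.of ℤ (FreeGroup X) (FreeGroup.of i)⁻¹) i
      rw [mul_sub, mul_assoc, ← map_mul, inv_mul_cancel, map_one, mul_one, mul_one] at this
      simpa using neg_mem this
    | mul g h hg hh =>
      intro r
      rw [map_mul, ← mul_assoc, ← sub_add_sub_cancel _ (r * MonoidAlgebra.of ℤ (FreeGroup X) g)]
      exact add_mem (hh _) (hg r)
  suffices h : ∃ c : ℤ, a - c • 1 ∈ Ψ.range by
    obtain ⟨c, b, hb⟩ := h
    exact ⟨c, b, by
      change Ψ b = _ at hb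
      rw [← sub_eq_iff_eq_add', ← hb]
      rfl⟩
  induction a using MonoidAlgebra.induction_on with
  | of g => exact ⟨1, by simpa using h1 g 1⟩
  | add a b ha hb =>
    obtain ⟨c, hc⟩ := ha
    obtain ⟨d, hd⟩ := hb
    refine ⟨c + d, ?_⟩
    rw [add_smul, add_sub_add_comm]
    exact add_mem hc hd
  | smul n a ha =>
    obtain ⟨c, hc⟩ := ha
    refine ⟨n * c, ?_⟩
    rw [mul_smul, ← smul_sub]
    exact zsmul_mem hc n

open NCPowerSeries in
/-- An endomorphism of a free group that is trivial on the abelianization does not change the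
leading terms of the images of the group ring in the ring of power series. -/
theorem map_sub_mem_orderGE {φ : FreeGroup X →* FreeGroup X}
    (hφ : ∀ g, Abelianization.of (φ g) = Abelianization.of g)
    {μ ν : MonoidAlgebra ℤ (FreeGroup X) →+* NCPowerSeries X}
    (hμ : ∀ g, μ (MonoidAlgebra.of ℤ _ g) = magnusMap X g)
    (hν : ∀ g, ν (MonoidAlgebra.of ℤ _ g) = magnusMap X (φ g)) (n : ℕ) :
    ∀ a, μ a ∈ orderGE X n → ν a - μ a ∈ orderGE X (n + 1) := by
  classical
  have hV := isMulFiltration_orderGE (X := X)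
  have hx : ∀ i, μ (MonoidAlgebra.of ℤ _ (FreeGroup.of i) - 1) = NCPowerSeries.var i := by
    intro i
    rw [map_sub, map_one, hμ, magnusMap_of, add_sub_cancel_left]
  have hvar : ∀ i : X, NCPowerSeries.var i ∈ orderGE X 1 := by
    intro i
    have := magnusMap_sub_one_mem (FreeGroup.of i)
    rwa [magnusMap_of, add_sub_cancel_left] at this
  have hy : ∀ i, ν (MonoidAlgebra.of ℤ _ (FreeGroup.of i) - 1) - NCPowerSeries.var i
      ∈ orderGE X 2 := by
    intro i
    have h := hV.map_sub_mem_two magnusMap_sub_one_mem hφ (FreeGroup.of i)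
    rwa [magnusMap_of, ← sub_sub, ← hν, ← map_one ν, ← map_sub] at h
  have hy1 : ∀ i, ν (MonoidAlgebra.of ℤ _ (FreeGroup.of i) - 1) ∈ orderGE X 1 := fun i => by
    simpa using add_mem (hV.anti one_le_two (hy i)) (hvar i)
  induction n with
  | zero =>
    intro a _
    obtain ⟨c, b, rfl⟩ := exists_fox_decomposition a
    simp only [map_add, map_zsmul, map_one, map_finsuppSum, map_mul, hx]
    rw [add_sub_add_left_eq_sub]
    exact sub_mem (sum_mem fun i _ => hV.mul_mem_right (hy1 i) _)
      (sum_mem fun i _ => hV.mul_mem_right (hvar i) _)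
  | succ n ih =>
    intro a ha
    obtain ⟨c, b, rfl⟩ := exists_fox_decomposition a
    simp only [map_add, map_zsmul, map_one, map_finsuppSum, map_mul, hx] at ha ⊢
    -- The coefficient at `v ++ [i]` comes from the summand `μ (b i) * X_i` alone and equals that of
    -- `μ (b i)` at `v`.
    have hb : ∀ i, μ (b i) ∈ orderGE X n := by
      intro i v hv
      let ev : NCPowerSeries X →+ ℤ := Pi.evalAddMonoidHom (fun _ : List X => ℤ) (v ++ [i])
      have h : ev (c • (1 : NCPowerSeries X) + b.sum fun i r => μ r * NCPowerSeries.var i) = 0 :=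
        ha (v ++ [i]) (by simp; omega)
      rw [map_add, map_zsmul, map_finsuppSum] at h
      have h1 : ev 1 = 0 := (NCPowerSeries.one_apply _).trans (by simp)
      have h2 : ∀ j r, ev (r * NCPowerSeries.var j) = if j = i then r v else 0 :=
        fun j r => mul_var_append r i j v
      simp only [h1, h2, smul_zero, zero_add] at h
      rw [Finsupp.sum, Finset.sum_ite_eq' b.support i] at h
      by_cases hi : i ∈ b.support
      · rwa [if_pos hi] at h
      · rw [Finsupp.notMem_support_iff.1 hi, map_zero]
        rfl
    rw [add_sub_add_left_eq_sub, Finsupp.sum, Finsupp.sum, ← Finset.sum_sub_distrib]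
    refine sum_mem fun i _ => ?_
    -- The induction hypothesis gains a degree in the first product; in the second, the IA condition
    -- does, on the generator.
    have e : ν (b i) * ν (MonoidAlgebra.of ℤ _ (FreeGroup.of i) - 1)
          - μ (b i) * NCPowerSeries.var i
        = (ν (b i) - μ (b i)) * ν (MonoidAlgebra.of ℤ _ (FreeGroup.of i) - 1)
          + μ (b i) * (ν (MonoidAlgebra.of ℤ _ (FreeGroup.of i) - 1) - NCPowerSeries.var i) := by
      noncomm_ring
    rw [e]
    exact add_mem (hV.mul_mem (ih _ (hb i)) (hy1 i)) (hV.mul_mem (hb i) (hy i) : _ ∈ orderGE X (n + 2))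

/-- The difference `a - b` makes sense in the group ring, which is why the preceding result is not
stated for group elements only. -/
theorem preservesLeadingDifference_magnusMap {φ : FreeGroup X →* FreeGroup X}
    (hφ : ∀ g, Abelianization.of (φ g) = Abelianization.of g) :
    PreservesLeadingDifference (fun _ => True)
      (fun a => (magnusMap X a : NCPowerSeries X)) φ := by
  intro a b w _ hab
  let μ : MonoidAlgebra ℤ (FreeGroup X) →+* NCPowerSeries X :=
    (MonoidAlgebra.lift ℤ (NCPowerSeries X) (FreeGroup X)
      ((Units.coeHom _).comp (magnusMap X))).toRingHom
  let ν : MonoidAlgebra ℤ (FreeGroup X) →+* NCPowerSeries X :=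
    (MonoidAlgebra.lift ℤ (NCPowerSeries X) (FreeGroup X)
      ((Units.coeHom _).comp ((magnusMap X).comp φ))).toRingHom
  have hμ : ∀ g, μ (MonoidAlgebra.of ℤ _ g) = magnusMap X g := fun g => by simp [μ]
  have hν : ∀ g, ν (MonoidAlgebra.of ℤ _ g) = magnusMap X (φ g) := fun g => by simp [ν]
  have h := map_sub_mem_orderGE hφ hμ hν w.length
    (MonoidAlgebra.of ℤ _ a - MonoidAlgebra.of ℤ _ b)
    (by
      rw [map_sub, hμ, hμ]
      exact fun v hv => sub_eq_zero.2 (hab v trivial hv)) w w.length.lt_succ_self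
  rw [map_sub, map_sub, hμ, hμ, hν, hν] at h
  exact sub_eq_zero.1 h

theorem isBiOrder_magnusLT (X : Type u) [LinearOrder X] : IsBiOrder (magnusLT X) :=
  isBiOrder_coeffLT (fun _ _ _ => ⟨trivial, trivial⟩)
    (fun a => (magnusMap X a : NCPowerSeries X)) (fun a b w _ => by rw [map_mul, Units.val_mul])
    magnusMap_nil
    (fun a b h => magnusMap_injective X (Units.ext (NCPowerSeries.ext fun w => h w trivial)))
    isLocallyFinite_magnusMap

end FreeIA

/-! ### Coefficients of elements of a reduced free group -/

/-- An element of a commutative group that is a combination of elements `c w` with dual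
functionals `ℓ w` lies in every subgroup that contains the `c w` with a nonzero coefficient. -/
theorem Subgroup.mem_of_dual {A W : Type*} [CommGroup A] [DecidableEq W] {c : W → A}
    {ℓ : W → A →* Multiplicative ℤ}
    (hℓ : ∀ v w, ℓ v (c w) = if v = w then Multiplicative.ofAdd 1 else 1) {a : A}
    (ha : a ∈ Subgroup.closure (Set.range c)) {Z : Subgroup A}
    (hZ : ∀ w, ℓ w a ≠ 1 → c w ∈ Z) : a ∈ Z := by
  obtain ⟨e, rfl⟩ := Subgroup.exists_finsupp_of_mem_closure_range c a ha
  refine Subgroup.prod_mem _ fun w hw => zpow_mem (hZ w ?_) _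
  -- The functional `ℓ w` reads off the exponent of `c w`.
  have h : ℓ w (e.prod fun v n => c v ^ n) = Multiplicative.ofAdd (e w) := by
    rw [map_finsuppProd, Finsupp.prod, Finset.prod_eq_single_of_mem w hw]
    · rw [map_zpow, hℓ, if_pos rfl, ← ofAdd_zsmul]
      simp
    · intro v _ hv
      rw [map_zpow, hℓ, if_neg hv.symm, one_zpow]
  rw [h]
  exact fun h0 => Finsupp.mem_support_iff.1 hw h0

namespace ReducedFreeGroup

open NCPowerSeries

variable {X : Type u}

/-- The projection from the free group. -/
def mk (X : Type u) : FreeGroup X →* ReducedFreeGroup X := PresentedGroup.mk (reducedRelators X)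

theorem mk_surjective : Function.Surjective (mk X) :=
  PresentedGroup.mk_surjective (reducedRelators X)

/-- The generators. -/
def gen (i : X) : ReducedFreeGroup X := mk X (FreeGroup.of i)

theorem gen_commute_conj (i : X) (g : ReducedFreeGroup X) :
    Commute (gen i) (g * gen i * g⁻¹) := by
  obtain ⟨g, rfl⟩ := mk_surjective g
  have h : mk X ⁅FreeGroup.of i, g * FreeGroup.of i * g⁻¹⁆ = 1 :=
    PresentedGroup.one_of_mem ⟨i, g, rfl⟩
  rw [map_commutatorElement, commutatorElement_eq_one_iff_commute, map_mul, map_mul, map_inv] at h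
  exact h

theorem reducedMagnusMap_mk (g : FreeGroup X) :
    (reducedMagnusMap X (mk X g) : ReducedNCPowerSeries X)
      = (repeatCon X).mk' (magnusMap X g : NCPowerSeries X) := by
  have h : (reducedMagnusMap X).comp (mk X) = (Units.map
      ((repeatCon X).mk' : NCPowerSeries X →* ReducedNCPowerSeries X)).comp (magnusMap X) := by
    ext i : 1
    have h1 : reducedMagnusMap X (mk X (FreeGroup.of i)) = reducedOneAddVar i :=
      PresentedGroup.toGroup.of reducedRelators_eq_one
    have h2 : magnusMap X (FreeGroup.of i) = oneAddVar i := FreeGroup.lift_apply_of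
    rw [MonoidHom.comp_apply, MonoidHom.comp_apply, h1, h2]
    rfl
  exact congrArg Units.val (DFunLike.congr_fun h g)

/-- The coefficients of the image of an element under the Magnus map. They depend on the choice
of a preimage in the free group, except at the words without a repeated letter. -/
noncomputable def coeffs (g : ReducedFreeGroup X) : NCPowerSeries X :=
  magnusMap X (Function.surjInv mk_surjective g)

theorem coeff_reducedMagnusMap (g : ReducedFreeGroup X) (w : {w : List X // w.Nodup}) :
    (reducedMagnusMap X g : ReducedNCPowerSeries X).coeff w = coeffs g w.1 := by
  conv_lhs => rw [← Function.surjInv_eq mk_surjective g, reducedMagnusMap_mk]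
  rfl

theorem coeffs_mk (g : FreeGroup X) {w : List X} (hw : w.Nodup) :
    coeffs (mk X g) w = (magnusMap X g : NCPowerSeries X) w := by
  rw [← coeff_reducedMagnusMap (mk X g) ⟨w, hw⟩, reducedMagnusMap_mk]
  rfl

theorem coeffs_nil (g : ReducedFreeGroup X) : coeffs g [] = 1 := magnusMap_nil _

theorem mul_apply_congr {f g f' g' : NCPowerSeries X} {w : List X} (hw : w.Nodup)
    (hf : ∀ v : List X, v.Nodup → v.length ≤ w.length → f v = f' v)
    (hg : ∀ v : List X, v.Nodup → v.length ≤ w.length → g v = g' v) :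
    (f * g) w = (f' * g') w := by
  rw [mul_apply, mul_apply]
  refine Finset.sum_congr rfl fun i _ => ?_
  rw [hf _ (hw.sublist (List.take_sublist i w)) (by simp),
    hg _ (hw.sublist (List.drop_sublist i w)) (by simp)]

theorem coeffs_mul (a b : ReducedFreeGroup X) {w : List X} (hw : w.Nodup) :
    coeffs (a * b) w = (coeffs a * coeffs b) w := by
  obtain ⟨a, rfl⟩ := mk_surjective a
  obtain ⟨b, rfl⟩ := mk_surjective b
  rw [← map_mul, coeffs_mk _ hw, map_mul, Units.val_mul]
  exact mul_apply_congr hw (fun v hv _ => (coeffs_mk a hv).symm)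
    fun v hv _ => (coeffs_mk b hv).symm

theorem coeffs_one {w : List X} (hw : w.Nodup) (h : w ≠ []) :
    coeffs (1 : ReducedFreeGroup X) w = 0 := by
  rw [← map_one (mk X), coeffs_mk _ hw, map_one, Units.val_one, NCPowerSeries.one_apply,
    if_neg (by simpa using h)]

theorem coeffs_gen (i : X) {w : List X} (hw : w.Nodup) :
    coeffs (gen i) w = (1 + NCPowerSeries.var i) w := by
  rw [gen, coeffs_mk _ hw, magnusMap_of]

theorem coeffs_gen_eq_zero {i m : X} (him : i ≠ m) {w : List X} (hw : w.Nodup) (hm : m ∈ w) :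
    coeffs (gen i) w = 0 := by
  classical
  rw [coeffs_gen i hw]
  cases w with
  | nil => simp at hm
  | cons a w =>
    rw [one_add_var_cons, if_neg]
    rintro ⟨rfl, rfl⟩
    simp [him.symm] at hm

theorem coeffs_gen_mul (i : X) (a : ReducedFreeGroup X) {w : List X} (hw : w.Nodup) :
    coeffs (gen i * a) w = ((1 + NCPowerSeries.var i) * coeffs a) w := by
  rw [coeffs_mul _ _ hw]
  exact mul_apply_congr hw (fun v hv _ => coeffs_gen i hv) fun _ _ _ => rfl

/-- A right factor without `X_m` does not affect the coefficients at the words that end in `m`. -/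
theorem coeffs_mul_append (a : ReducedFreeGroup X) {b : ReducedFreeGroup X} {m : X}
    (hb : ∀ v : List X, v.Nodup → m ∈ v → coeffs b v = 0) {w : List X} (hw : (w ++ [m]).Nodup) :
    coeffs (a * b) (w ++ [m]) = coeffs a (w ++ [m]) := by
  rw [coeffs_mul _ _ hw, mul_apply, Finset.sum_eq_single (w ++ [m]).length]
  · rw [List.take_length, List.drop_length, coeffs_nil, mul_one]
  · intro i hi hi'
    rw [hb _ (hw.sublist (List.drop_sublist i _)), mul_zero]
    have : i ≤ w.length := by simp at hi hi'; omega
    rw [List.drop_append_of_le_length this]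
    simp
  · simp

/-! ### Killing a generator -/

open Classical in
/-- The series without the terms that contain `X_m`. -/
noncomputable def killTerms (m : X) (f : NCPowerSeries X) : NCPowerSeries X :=
  fun w => if m ∈ w then 0 else f w

open Classical in
theorem killTerms_apply (m : X) (f : NCPowerSeries X) (w : List X) :
    killTerms m f w = if m ∈ w then 0 else f w := rfl

/-- The substitution `X_m = 0`. -/
noncomputable def killSeries (m : X) : NCPowerSeries X →+* NCPowerSeries X where
  toFun := killTerms m
  map_zero' := by ext w; simp [killTerms_apply, NCPowerSeries.zero_apply]
  map_one' := by
    ext w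
    cases w <;> simp [killTerms_apply, NCPowerSeries.one_apply]
  map_add' f g := by
    ext w
    by_cases h : m ∈ w <;> simp [killTerms_apply, NCPowerSeries.add_apply, h]
  map_mul' f g := by
    ext w
    rw [killTerms_apply, mul_apply, mul_apply]
    by_cases h : m ∈ w
    · rw [if_pos h]
      refine (Finset.sum_eq_zero fun i _ => ?_).symm
      rw [← List.take_append_drop i w, List.mem_append] at h
      rcases h with h | h <;> simp [killTerms_apply, h]
    · rw [if_neg h]
      refine Finset.sum_congr rfl fun i _ => ?_
      rw [killTerms_apply, killTerms_apply, if_neg fun h' => h (List.mem_of_mem_take h'),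
        if_neg fun h' => h (List.mem_of_mem_drop h')]

open Classical in
theorem killSeries_apply (m : X) (f : NCPowerSeries X) (w : List X) :
    killSeries m f w = if m ∈ w then 0 else f w := rfl

open Classical in
/-- The endomorphism that maps the generator `x_m` to `1` and fixes the others. -/
noncomputable def kill (m : X) : ReducedFreeGroup X →* ReducedFreeGroup X :=
  PresentedGroup.toGroup (rels := reducedRelators X) (f := fun j => if j = m then 1 else gen j) <| by
    rintro r ⟨j, g, rfl⟩
    rw [map_commutatorElement, commutatorElement_eq_one_iff_commute, map_mul, map_mul, map_inv,
      FreeGroup.lift_apply_of]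
    by_cases h : j = m
    · rw [if_pos h]
      exact Commute.one_left _
    · rw [if_neg h]
      exact gen_commute_conj j _

open Classical in
theorem kill_gen (m j : X) : kill m (gen j) = if j = m then 1 else gen j :=
  PresentedGroup.toGroup.of _

open Classical in
-- Killing `x_m` corresponds to the substitution `X_m = 0`; this is checked on generators after
-- lifting to the free group.
theorem coeffs_kill (m : X) (g : ReducedFreeGroup X) {w : List X} (hw : w.Nodup) :
    coeffs (kill m g) w = if m ∈ w then 0 else coeffs g w := by
  obtain ⟨g, rfl⟩ := mk_surjective g
  let κ : FreeGroup X →* FreeGroup X := FreeGroup.lift fun j => if j = m then 1 else FreeGroup.of j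
  have h1 : (kill m).comp (mk X) = (mk X).comp κ := by
    ext j : 1
    have : kill m (mk X (FreeGroup.of j)) = _ := kill_gen m j
    rw [MonoidHom.comp_apply, MonoidHom.comp_apply, this, FreeGroup.lift_apply_of]
    split_ifs
    · rw [map_one]
    · rfl
  have h2 : (magnusMap X).comp κ = (Units.map (killSeries m : NCPowerSeries X →* _)).comp
      (magnusMap X) := by
    ext j : 2
    rw [MonoidHom.comp_apply, MonoidHom.comp_apply, FreeGroup.lift_apply_of, Units.coe_map,
      magnusMap_of]
    change _ = killSeries m (1 + NCPowerSeries.var j)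
    ext w
    rw [killSeries_apply]
    split_ifs with h h' h'
    · rw [map_one, Units.val_one, NCPowerSeries.one_apply, if_neg]
      intro h0
      simp [List.length_eq_zero_iff.1 h0] at h'
    · subst h
      rw [map_one, Units.val_one]
      cases w with
      | nil => rw [one_add_var_nil]; rfl
      | cons a w =>
        rw [one_add_var_cons, if_neg (fun h0 => h' (by simp [h0.1]))]
        simp [NCPowerSeries.one_apply]
    · rw [magnusMap_of]
      cases w with
      | nil => simp at h'
      | cons a w =>
        rw [one_add_var_cons, if_neg]
        rintro ⟨rfl, rfl⟩
        exact h (by simpa [eq_comm] using h')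
    · rw [magnusMap_of]
  have h1' : kill m (mk X g) = mk X (κ g) := DFunLike.congr_fun h1 g
  have h2' : (magnusMap X (κ g) : NCPowerSeries X) = killSeries m (magnusMap X g) :=
    congrArg Units.val (DFunLike.congr_fun h2 g)
  rw [h1', coeffs_mk _ hw, h2', killSeries_apply, coeffs_mk _ hw]

/-- The normal closure of a generator. -/
def genClosure (m : X) : Subgroup (ReducedFreeGroup X) := Subgroup.normalClosure {gen m}

instance (m : X) : (genClosure m).Normal := Subgroup.normalClosure_normal

theorem gen_mem_genClosure (m : X) : gen m ∈ genClosure m :=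
  Subgroup.subset_normalClosure rfl

/-- The defining relations say that conjugates of `x_m` commute: conjugate the relation for `p⁻¹ *
q` by `p`. -/
theorem genClosure_mul_comm (m : X) {a b : ReducedFreeGroup X} (ha : a ∈ genClosure m)
    (hb : b ∈ genClosure m) : a * b = b * a := by
  have h := Subgroup.isMulCommutative_closure (k := Group.conjugatesOfSet {gen m}) (by
    intro x hx y hy
    obtain ⟨_, rfl, hx⟩ := Group.mem_conjugatesOfSet_iff.1 hx
    obtain ⟨_, rfl, hy⟩ := Group.mem_conjugatesOfSet_iff.1 hy
    obtain ⟨p, rfl⟩ := isConj_iff.1 hx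
    obtain ⟨q, rfl⟩ := isConj_iff.1 hy
    have h := (gen_commute_conj m (p⁻¹ * q)).map (MulAut.conj p)
    have e : MulAut.conj p (p⁻¹ * q * gen m * (p⁻¹ * q)⁻¹) = q * gen m * q⁻¹ := by
      rw [MulAut.conj_apply]; group
    rw [e] at h
    exact h.eq)
  exact congrArg Subtype.val (h.is_comm.comm ⟨a, ha⟩ ⟨b, hb⟩)

theorem kill_eq_one {m : X} {a : ReducedFreeGroup X} (ha : a ∈ genClosure m) : kill m a = 1 := by
  have : genClosure m ≤ (kill m).ker := by
    refine Subgroup.normalClosure_le_normal ?_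
    rintro _ rfl
    exact (kill_gen m m).trans (if_pos rfl)
  exact this ha

theorem coeffs_eq_zero {m : X} {a : ReducedFreeGroup X} (ha : a ∈ genClosure m) {w : List X}
    (hw : w.Nodup) (h0 : w ≠ []) (hm : m ∉ w) : coeffs a w = 0 := by
  classical
  have h := coeffs_kill m a hw
  rw [kill_eq_one ha, coeffs_one hw h0, if_neg hm] at h
  exact h.symm

/-- Modulo the normal closure of `x_m`, `kill m` fixes every generator. -/
theorem mul_kill_inv_mem (m : X) (g : ReducedFreeGroup X) : g * (kill m g)⁻¹ ∈ genClosure m := by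
  classical
  have h : ((QuotientGroup.mk' (genClosure m)).comp (kill m)).comp (mk X)
      = (QuotientGroup.mk' (genClosure m)).comp (mk X) := by
    ext j : 1
    have : kill m (mk X (FreeGroup.of j)) = _ := kill_gen m j
    simp only [MonoidHom.comp_apply, this]
    split_ifs with hj
    · subst hj
      rw [map_one]
      exact ((QuotientGroup.eq_one_iff _).2 (gen_mem_genClosure j)).symm
    · rfl
  obtain ⟨g, rfl⟩ := mk_surjective g
  have h' : QuotientGroup.mk' (genClosure m) (kill m (mk X g))
      = QuotientGroup.mk' (genClosure m) (mk X g) := DFunLike.congr_fun h g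
  rw [← QuotientGroup.eq_one_iff]
  change QuotientGroup.mk' (genClosure m) _ = 1
  rw [map_mul, map_inv, h', mul_inv_cancel]

/-- Proper nonempty prefixes of `w ++ [m]` avoid `m`, so `a` has coefficient zero there, and only
the two extreme splittings contribute. -/
theorem coeffs_mul_of_mem {m : X} {a b : ReducedFreeGroup X} (ha : a ∈ genClosure m) {w : List X}
    (hw : (w ++ [m]).Nodup) :
    coeffs (a * b) (w ++ [m]) = coeffs a (w ++ [m]) + coeffs b (w ++ [m]) := by
  rw [coeffs_mul _ _ hw, mul_apply,
    Finset.sum_eq_add_of_mem (w ++ [m]).length 0 (by simp) (by simp) (by simp)]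
  · rw [List.take_length, List.drop_length, coeffs_nil, List.take_zero, coeffs_nil, List.drop_zero,
      mul_one, one_mul]
  · rintro i hi ⟨hi1, hi2⟩
    have hi' : i ≤ w.length := by simp at hi hi1; omega
    rw [coeffs_eq_zero ha (hw.sublist (List.take_sublist i _)), zero_mul]
    · simp [hi2]
    · rw [List.take_append_of_le_length hi']
      exact fun h => (List.nodup_append.1 hw).2.2 m (List.mem_of_mem_take h) m (by simp) rfl

/-! ### Nested commutators -/

/-- `[x_{w_1}, [x_{w_2}, ⋯ [x_{w_k}, x_m]]]`. -/
def nestedCommutator (m : X) : List X → ReducedFreeGroup X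
  | [] => gen m
  | i :: w => ⁅gen i, nestedCommutator m w⁆

theorem commutator_mem_of_right {G : Type*} [Group G] {N : Subgroup G} [hN : N.Normal] (a : G)
    {b : G} (hb : b ∈ N) : ⁅a, b⁆ ∈ N := by
  rw [commutatorElement_def]
  exact mul_mem (hN.conj_mem b hb a) (inv_mem hb)

theorem nestedCommutator_mem (m : X) (w : List X) : nestedCommutator m w ∈ genClosure m := by
  induction w with
  | nil => exact gen_mem_genClosure m
  | cons i w ih => exact commutator_mem_of_right _ ih

theorem nestedCommutator_mem_of_mem {m i : X} {w : List X} (hi : i ∈ w) :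
    nestedCommutator m w ∈ genClosure i := by
  induction w with
  | nil => simp at hi
  | cons j w ih =>
    rcases List.mem_cons.1 hi with rfl | hi
    · rw [nestedCommutator, ← commutatorElement_inv]
      exact inv_mem (commutator_mem_of_right _ (gen_mem_genClosure i))
    · exact commutator_mem_of_right _ (ih hi)

theorem nestedCommutator_mem_lowerCentralSeries (m : X) (w : List X) :
    nestedCommutator m w ∈
      (⊤ : Subgroup (ReducedFreeGroup X)).lowerCentralSeries w.length := by
  induction w with
  | nil => exact Subgroup.mem_top _
  | cons i w ih =>
    rw [nestedCommutator, ← commutatorElement_inv, List.length_cons,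
      Subgroup.lowerCentralSeries_succ]
    exact inv_mem (Subgroup.commutator_mem_commutator ih (Subgroup.mem_top _))

open Classical in
-- Compare both sides of `x_i c = ⁅x_i, c⁆ c x_i` at words ending in `m`. The last factor has no
-- effect and the coefficients of the other two add up, so `⁅x_i, c⁆` has there the coefficients of
-- `X_i` times the series of `c`.
theorem coeffs_nestedCommutator {m : X} {w : List X} (hw : (w ++ [m]).Nodup) :
    ∀ {v : List X}, (v ++ [m]).Nodup →
      coeffs (nestedCommutator m w) (v ++ [m]) = if v = w then 1 else 0 := by
  induction w with
  | nil =>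
    intro v hv
    rw [nestedCommutator, coeffs_gen m hv]
    cases v with
    | nil => rw [List.nil_append, one_add_var_cons]; simp
    | cons a v => rw [List.cons_append, one_add_var_cons]; simp
  | cons i w ih =>
    intro v hv
    have him : i ≠ m := fun h => (List.nodup_cons.1 hw).1 (by simp [h])
    have ih' := @ih (List.nodup_cons.1 hw).2
    set c := nestedCommutator m w with hc
    have hcN : c ∈ genClosure m := nestedCommutator_mem m w
    have hd : ⁅gen i, c⁆ ∈ genClosure m := commutator_mem_of_right _ hcN
    have e : gen i * c = ⁅gen i, c⁆ * c * gen i := by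
      rw [commutatorElement_def]; group
    have h1 : coeffs (gen i * c) (v ++ [m]) = coeffs (⁅gen i, c⁆ * c * gen i) (v ++ [m]) := by
      rw [← e]
    rw [coeffs_mul_append _ (fun u hu hmu => coeffs_gen_eq_zero him hu hmu) hv,
      coeffs_mul_of_mem hd hv, coeffs_gen_mul i c hv] at h1
    change coeffs ⁅gen i, c⁆ _ = _
    cases v with
    | nil =>
      rw [one_add_var_mul_apply i _ (by simpa using him.symm)] at h1
      simp only [List.nil_eq, reduceCtorEq, if_false]
      linarith
    | cons a v =>
      by_cases ha : a = i
      · subst ha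
        rw [List.cons_append, one_add_var_mul_cons, ih' (List.nodup_cons.1 hv).2] at h1
        simp only [List.cons_append, List.cons.injEq, true_and] at h1 ⊢
        linarith
      · rw [one_add_var_mul_apply i _ (by simpa using ha)] at h1
        rw [if_neg (by simp [ha])]
        linarith

/-- A repeated letter `i` places both elements in the abelian normal closure of `x_i`. -/
theorem gen_conj_nestedCommutator {m i : X} {w : List X} (h : ¬ (i :: w ++ [m]).Nodup)
    (hw : (w ++ [m]).Nodup) : gen i * nestedCommutator m w = nestedCommutator m w * gen i := by
  have hi : i ∈ w ++ [m] := by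
    by_contra h'
    exact h (List.nodup_cons.2 ⟨h', hw⟩)
  refine genClosure_mul_comm i (gen_mem_genClosure i) ?_
  rcases List.mem_append.1 hi with hi | hi
  · exact nestedCommutator_mem_of_mem hi
  · rw [List.mem_singleton.1 hi]
    exact nestedCommutator_mem m w

/-- The subgroup generated by the nested commutators without repetitions that end in `x_m`. -/
def nestedClosure (m : X) : Subgroup (ReducedFreeGroup X) :=
  Subgroup.closure
    (Set.range fun w : {w : List X // (w ++ [m]).Nodup} => nestedCommutator m w.1)

theorem nestedCommutator_mem_nestedClosure {m : X} {w : List X} (hw : (w ++ [m]).Nodup) :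
    nestedCommutator m w ∈ nestedClosure m :=
  Subgroup.subset_closure ⟨⟨w, hw⟩, rfl⟩

/-- With `c` the nested commutator, `x_i c x_i⁻¹ = ⁅x_i, c⁆ c`. Since `⁅x_i, c⁆` commutes with
`x_i`, also `x_i⁻¹ c x_i = ⁅x_i, c⁆⁻¹ c`. If `i` repeats a letter, `x_i` commutes with `c`. -/
theorem conj_gen_mem_nestedClosure {m : X} (i : X) {w : List X} (hw : (w ++ [m]).Nodup) :
    gen i * nestedCommutator m w * (gen i)⁻¹ ∈ nestedClosure m ∧
      (gen i)⁻¹ * nestedCommutator m w * gen i ∈ nestedClosure m := by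
  have hc := nestedCommutator_mem_nestedClosure hw
  by_cases h : (i :: w ++ [m]).Nodup
  · have hd : ⁅gen i, nestedCommutator m w⁆ ∈ nestedClosure m :=
      nestedCommutator_mem_nestedClosure h
    have hcomm : gen i * ⁅gen i, nestedCommutator m w⁆ = ⁅gen i, nestedCommutator m w⁆ * gen i :=
      genClosure_mul_comm i (gen_mem_genClosure i)
        (nestedCommutator_mem_of_mem (w := i :: w) (by simp))
    constructor
    · have e : gen i * nestedCommutator m w * (gen i)⁻¹
          = ⁅gen i, nestedCommutator m w⁆ * nestedCommutator m w := by
        rw [commutatorElement_def]; group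
      rw [e]
      exact mul_mem hd hc
    · have e : (gen i)⁻¹ * nestedCommutator m w * gen i
          = ⁅gen i, nestedCommutator m w⁆⁻¹ * nestedCommutator m w := by
        rw [eq_inv_mul_iff_mul_eq, ← mul_assoc, ← mul_assoc,
          (Commute.inv_right (Commute.symm hcomm)).eq, commutatorElement_def]
        group
      rw [e]
      exact mul_mem (inv_mem hd) hc
  · have hcomm := gen_conj_nestedCommutator h hw
    constructor
    · rwa [hcomm, mul_inv_cancel_right]
    · rwa [mul_assoc, ← hcomm, inv_mul_cancel_left]

theorem nestedClosure_normal (m : X) : (nestedClosure m).Normal := by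
  have key : ∀ g x : ReducedFreeGroup X,
      (∀ w : List X, (w ++ [m]).Nodup → g * nestedCommutator m w * g⁻¹ ∈ nestedClosure m) →
      x ∈ nestedClosure m → g * x * g⁻¹ ∈ nestedClosure m := by
    intro g x hg hx
    have h : nestedClosure m ≤ (nestedClosure m).comap (MulAut.conj g).toMonoidHom := by
      rw [nestedClosure, Subgroup.closure_le]
      rintro _ ⟨w, rfl⟩
      exact hg w.1 w.2
    exact h hx
  refine ⟨fun x hx g => ?_⟩
  obtain ⟨g, rfl⟩ := mk_surjective g
  induction g using FreeGroup.induction_on generalizing x with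
  | C1 => simpa using hx
  | of i => exact key _ x (fun w hw => (conj_gen_mem_nestedClosure i hw).1) hx
  | inv_of i _ =>
    refine key _ x (fun w hw => ?_) hx
    rw [map_inv, inv_inv]
    exact (conj_gen_mem_nestedClosure i hw).2
  | mul g h hg hh =>
    have := hg _ (hh x hx)
    rw [map_mul, mul_inv_rev]
    simpa only [mul_assoc] using this

theorem genClosure_le_nestedClosure (m : X) : genClosure m ≤ nestedClosure m := by
  have := nestedClosure_normal m
  refine Subgroup.normalClosure_le_normal ?_
  rintro _ rfl
  exact nestedCommutator_mem_nestedClosure (w := []) (by simp)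

/-- The nested commutators generate this abelian normal closure, and the coefficients at words
ending in `m` are homomorphisms on it, dual to them. -/
theorem mem_of_mem_genClosure {m : X} {a : ReducedFreeGroup X} (ha : a ∈ genClosure m)
    {Z : Subgroup (ReducedFreeGroup X)}
    (hZ : ∀ w : List X, (w ++ [m]).Nodup → coeffs a (w ++ [m]) ≠ 0 → nestedCommutator m w ∈ Z) :
    a ∈ Z := by
  classical
  let : CommGroup (genClosure m) :=
    { (inferInstance : Group (genClosure m)) with
      mul_comm := fun a b => Subtype.ext (genClosure_mul_comm m a.2 b.2) }
  let c : {w : List X // (w ++ [m]).Nodup} → genClosure m :=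
    fun w => ⟨nestedCommutator m w.1, nestedCommutator_mem m w.1⟩
  let ℓ : {w : List X // (w ++ [m]).Nodup} → genClosure m →* Multiplicative ℤ := fun w =>
    MonoidHom.mk' (fun a => Multiplicative.ofAdd (coeffs a.1 (w.1 ++ [m])))
      fun a b => congrArg Multiplicative.ofAdd (coeffs_mul_of_mem a.2 w.2)
  have hℓ : ∀ v w, ℓ v (c w) = if v = w then Multiplicative.ofAdd 1 else 1 := by
    intro v w
    refine (congrArg Multiplicative.ofAdd (coeffs_nestedCommutator w.2 v.2)).trans ?_
    by_cases h : v = w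
    · rw [if_pos h, if_pos (congrArg Subtype.val h)]
    · rw [if_neg h, if_neg fun h' => h (Subtype.ext h')]
      rfl
  have hmem : (⟨a, ha⟩ : genClosure m) ∈ Subgroup.closure (Set.range c) := by
    have h : a ∈ (Subgroup.closure (Set.range c)).map (genClosure m).subtype := by
      rw [MonoidHom.map_closure, ← Set.range_comp]
      exact genClosure_le_nestedClosure m ha
    obtain ⟨b, hb, hba⟩ := h
    rwa [show (⟨a, ha⟩ : genClosure m) = b from Subtype.ext hba.symm]
  exact Subgroup.mem_of_dual (Z := Z.comap (genClosure m).subtype) hℓ hmem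
    fun w hw => hZ w.1 w.2 fun h0 => hw (congrArg Multiplicative.ofAdd h0)

/-! ### Membership in subgroups read off from coefficients -/

theorem exists_mem_closure_gen (g : ReducedFreeGroup X) :
    ∃ s : Finset X, g ∈ Subgroup.closure (gen '' (s : Set X)) := by
  classical
  obtain ⟨g, rfl⟩ := mk_surjective g
  induction g using FreeGroup.induction_on with
  | C1 => exact ⟨∅, by rw [map_one]; exact one_mem _⟩
  | of i => exact ⟨{i}, Subgroup.subset_closure ⟨i, by simp, rfl⟩⟩
  | inv_of i h =>
    obtain ⟨s, hs⟩ := h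
    exact ⟨s, by rw [map_inv]; exact inv_mem hs⟩
  | mul g h hg hh =>
    obtain ⟨s, hs⟩ := hg
    obtain ⟨t, ht⟩ := hh
    refine ⟨s ∪ t, ?_⟩
    rw [map_mul]
    refine mul_mem (Subgroup.closure_mono (Set.image_mono ?_) hs)
      (Subgroup.closure_mono (Set.image_mono ?_) ht) <;> simp

/-- An element of a reduced free group lies in every subgroup that contains the nested
commutators at whose words it has a nonzero coefficient. -/
theorem mem_of_nestedCommutator_mem {a : ReducedFreeGroup X} {Z : Subgroup (ReducedFreeGroup X)}
    (hZ : ∀ (m : X) (w : List X), (w ++ [m]).Nodup → coeffs a (w ++ [m]) ≠ 0 →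
      nestedCommutator m w ∈ Z) : a ∈ Z := by
  classical
  obtain ⟨s, hs⟩ := exists_mem_closure_gen a
  induction s using Finset.induction_on generalizing a with
  | empty =>
    simp only [Finset.coe_empty, Set.image_empty, Subgroup.closure_empty] at hs
    rw [Subgroup.mem_bot.1 hs]
    exact one_mem _
  | insert m s _ ih =>
    -- Split `a` as `(a * (kill m a)⁻¹) * kill m a`. The second factor involves fewer generators and
    -- only loses coefficients; the first lies in the normal closure of `x_m` and has the
    -- coefficients of `a` at words ending in `m`.
    have h1 : kill m a ∈ Z := by
      refine ih (fun m' w hw h => hZ m' w hw fun h0 => h ?_) ?_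
      · rw [coeffs_kill m a hw, h0, ite_self]
      · have : Subgroup.closure (gen '' ((insert m s : Finset X) : Set X))
            ≤ (Subgroup.closure (gen '' (s : Set X))).comap (kill m) := by
          rw [Subgroup.closure_le]
          rintro _ ⟨j, hj, rfl⟩
          change kill m (gen j) ∈ Subgroup.closure (gen '' (s : Set X))
          rw [kill_gen]
          split_ifs with h
          · exact one_mem _
          · exact Subgroup.subset_closure ⟨j, by simpa [h] using hj, rfl⟩
        exact this hs
    have h2 : a * (kill m a)⁻¹ ∈ Z := by
      refine mem_of_mem_genClosure (mul_kill_inv_mem m a) fun w hw h => hZ m w hw ?_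
      rwa [← coeffs_mul_append (a * (kill m a)⁻¹) (b := kill m a)
        (fun v hv hm => by rw [coeffs_kill m a hv, if_pos hm]) hw, inv_mul_cancel_right] at h
    simpa using mul_mem h2 h1

theorem coeffs_mul_inv_eq_zero {a b : ReducedFreeGroup X} {w : List X} (hw : w.Nodup)
    (h0 : w ≠ []) (h : ∀ v : List X, v.Nodup → v.length ≤ w.length → coeffs a v = coeffs b v) :
    coeffs (a * b⁻¹) w = 0 := by
  rw [coeffs_mul _ _ hw, mul_apply_congr hw h (fun _ _ _ => rfl), ← coeffs_mul _ _ hw,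
    mul_inv_cancel, coeffs_one hw h0]

/-- Milnor: the reduced Magnus map is injective. -/
theorem eq_of_coeffs_eq {a b : ReducedFreeGroup X}
    (h : ∀ w : List X, w.Nodup → coeffs a w = coeffs b w) : a = b := by
  have h1 : a * b⁻¹ ∈ (⊥ : Subgroup (ReducedFreeGroup X)) :=
    mem_of_nestedCommutator_mem fun m w hw hne =>
      absurd (coeffs_mul_inv_eq_zero hw (by simp) fun v hv _ => h v hv) hne
  exact mul_inv_eq_one.1 (Subgroup.mem_bot.1 h1)

/-! ### IA-endomorphisms of a reduced free group -/

/-- The reduced series without terms of degree less than `n`. -/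
def reducedOrderGE (X : Type u) (n : ℕ) : AddSubgroup (ReducedNCPowerSeries X) :=
  (orderGE X n).map ((repeatCon X).mk' : NCPowerSeries X →+ ReducedNCPowerSeries X)

theorem mk_mem_reducedOrderGE {n : ℕ} {f : NCPowerSeries X} :
    (repeatCon X).mk' f ∈ reducedOrderGE X n ↔
      ∀ w : List X, w.Nodup → w.length < n → f w = 0 := by
  constructor
  · rintro ⟨g, hg, hgf⟩ w hw hwn
    have h : repeatCon X g f := (RingCon.eq _).1 hgf
    rw [← h w hw]
    exact hg w hwn
  · intro h
    -- Truncation changes `f` only at words with a repeated letter.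
    refine ⟨fun w => if w.length < n then 0 else f w, fun w hw => if_pos hw, ?_⟩
    refine (RingCon.eq _).2 fun w hw => ?_
    by_cases hwn : w.length < n
    · rw [if_pos hwn, h w hw hwn]
    · rw [if_neg hwn]

theorem isMulFiltration_reducedOrderGE : IsMulFiltration (reducedOrderGE X) where
  mem_zero r := by
    obtain ⟨f, rfl⟩ := (repeatCon X).mk'_surjective r
    exact ⟨f, isMulFiltration_orderGE.mem_zero f, rfl⟩
  anti m n hmn := AddSubgroup.map_mono (isMulFiltration_orderGE.anti hmn)
  mul_mem := by
    rintro m n _ _ ⟨f, hf, rfl⟩ ⟨g, hg, rfl⟩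
    exact ⟨f * g, isMulFiltration_orderGE.mul_mem hf hg, map_mul (repeatCon X).mk' f g⟩

theorem reducedMagnusMap_eq (g : ReducedFreeGroup X) :
    (reducedMagnusMap X g : ReducedNCPowerSeries X) = (repeatCon X).mk' (coeffs g) := by
  conv_lhs => rw [← Function.surjInv_eq mk_surjective g, reducedMagnusMap_mk]
  rfl

theorem reducedMagnusMap_sub_one_mem (g : ReducedFreeGroup X) :
    (reducedMagnusMap X g : ReducedNCPowerSeries X) - 1 ∈ reducedOrderGE X 1 := by
  rw [reducedMagnusMap_eq, ← map_one (repeatCon X).mk', ← map_sub, mk_mem_reducedOrderGE]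
  intro w _ hw
  obtain rfl : w = [] := List.length_eq_zero_iff.1 (by omega)
  rw [sub_apply, coeffs_nil]
  rfl

theorem preservesLeadingDifference_coeffs {φ : ReducedFreeGroup X →* ReducedFreeGroup X}
    (hφ : ∀ g, Abelianization.of (φ g) = Abelianization.of g) :
    PreservesLeadingDifference List.Nodup (coeffs (X := X)) φ := by
  intro a b w hw hab
  have hV := isMulFiltration_reducedOrderGE (X := X)
  have hμ := reducedMagnusMap_sub_one_mem (X := X)
  cases hn : w.length with
  | zero =>
    obtain rfl := List.length_eq_zero_iff.1 hn
    simp only [coeffs_nil]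
  | succ k =>
    -- All coefficients of `a * b⁻¹` in degrees 1 to `k` vanish, so only nested commutators of
    -- weight at least `k + 1` are detected.
    have hg : a * b⁻¹ ∈ (⊤ : Subgroup (ReducedFreeGroup X)).lowerCentralSeries k := by
      refine mem_of_nestedCommutator_mem fun m v hv hne => ?_
      refine Subgroup.lowerCentralSeries_antitone _ ?_ (nestedCommutator_mem_lowerCentralSeries m v)
      by_contra hlt
      exact hne (coeffs_mul_inv_eq_zero hv (by simp) fun u hu huv =>
        hab u hu (huv.trans_lt (by simp; omega)))
    have h1 := hV.sub_one_mem_of_mem_lowerCentralSeries hμ k hg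
    have h2 := hV.map_sub_mem_of_mem_lowerCentralSeries hμ hφ k hg
    have h3 := hV.anti one_le_two (hV.map_sub_mem_two hμ hφ b)
    have h4 := add_mem (hV.mul_mem_left h2 (reducedMagnusMap X (φ b)))
      (hV.mul_mem h1 h3 : _ ∈ reducedOrderGE X (k + 1 + 1))
    have ea : ∀ ψ : ReducedFreeGroup X →* ReducedFreeGroup X,
        (reducedMagnusMap X (ψ (a * b⁻¹)) : ReducedNCPowerSeries X) * reducedMagnusMap X (ψ b)
          = reducedMagnusMap X (ψ a) := by
      intro ψ
      rw [← Units.val_mul, ← map_mul, ← map_mul, inv_mul_cancel_right]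
    have e1 := ea φ
    have e2 := ea (MonoidHom.id _)
    simp only [MonoidHom.id_apply] at e2
    -- With `g = a * b⁻¹` this is `(φ g - g) φ b + (g - 1) (φ b - b) = (φ a - φ b) - (a - b)`; both
    -- products have order at least `k + 2`.
    have e : ((reducedMagnusMap X (φ (a * b⁻¹)) : ReducedNCPowerSeries X)
          - reducedMagnusMap X (a * b⁻¹)) * reducedMagnusMap X (φ b)
        + (reducedMagnusMap X (a * b⁻¹) - 1) * (reducedMagnusMap X (φ b) - reducedMagnusMap X b)
        = (repeatCon X).mk' (coeffs (φ a) - coeffs (φ b) - (coeffs a - coeffs b)) := by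
      simp only [map_sub, ← reducedMagnusMap_eq]
      rw [← e1, ← e2]
      noncomm_ring
    rw [e, mk_mem_reducedOrderGE] at h4
    have := h4 w hw (by omega)
    rw [sub_apply, sub_apply, sub_apply] at this
    exact sub_eq_zero.1 this

theorem reducedMagnusLT_iff [LinearOrder X] {a b : ReducedFreeGroup X} :
    reducedMagnusLT X a b ↔
      coeffLT (P := List.Nodup) (fun w => coeffs a w.1) (fun w => coeffs b w.1) := by
  rw [reducedMagnusLT, funext (coeff_reducedMagnusMap a), funext (coeff_reducedMagnusMap b)]

theorem isBiOrder_reducedMagnusLT (X : Type u) [LinearOrder X] : IsBiOrder (reducedMagnusLT X) := by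
  have h := isBiOrder_coeffLT (P := List.Nodup)
    (fun u v h => ⟨h.sublist (List.sublist_append_left u v),
      h.sublist (List.sublist_append_right u v)⟩) (coeffs (X := X))
    (fun a b w hw => coeffs_mul a b hw) coeffs_nil (fun a b => eq_of_coeffs_eq)
    fun a => isLocallyFinite_magnusMap _
  have e : reducedMagnusLT X = _ := funext fun a => funext fun b => propext reducedMagnusLT_iff
  rw [e]
  exact h

end ReducedFreeGroup

/-! ### Almost-direct products -/

theorem isBiOrder_factorLT (t : FactorKind) (X : Type u) [LinearOrder X] :
    IsBiOrder (factorLT t X) :=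
  match t with
  | .free => isBiOrder_magnusLT X
  | .reduced => ReducedFreeGroup.isBiOrder_reducedMagnusLT X

/-- The (reduced) Magnus order is preserved by the endomorphisms that are trivial on the
abelianization. -/
theorem factorLT_map (t : FactorKind) (X : Type u) [LinearOrder X]
    (φ : Factor t X →* Factor t X) (hφ : ∀ g, Abelianization.of (φ g) = Abelianization.of g)
    {a b : Factor t X} (h : factorLT t X a b) : factorLT t X (φ a) (φ b) :=
  match t with
  | .free => (preservesLeadingDifference_magnusMap hφ).coeffLT h
  | .reduced => ReducedFreeGroup.reducedMagnusLT_iff.2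
      ((ReducedFreeGroup.preservesLeadingDifference_coeffs hφ).coeffLT
        (ReducedFreeGroup.reducedMagnusLT_iff.1 h))

theorem AlmostDirectProduct.isBiOrder_lexLT {t : FactorKind} {G : Type u} {iG : Group G}
    (D : AlmostDirectProduct t G iG) : IsBiOrder D.lexLT := by
  induction D with
  | single X => exact isBiOrder_factorLT t X
  | semidirect D X α hα ih =>
    exact (isBiOrder_factorLT t X).easternLex ih fun q a b h =>
      factorLT_map t X (α q).toMonoidHom (hα q) h

theorem theorem1p1 (t : FactorKind) (P : Type u) (iP : Group P)
    (D : AlmostDirectProduct t P iP) (G : Type u) [Group G] (e : G ≃* P) :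
    BiOrderable G ∧ IsBiOrder (fun a b : G => D.lexLT (e a) (e b)) :=
  have h := D.isBiOrder_lexLT.comap e
  ⟨⟨_, h⟩, h⟩
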